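/- Let $k$ be a field of characteristic zero, $V$ a $k$-vector space (of any dimension), and let $k[V]$ be the symmetric algebra of $V$ with its coproduct $\Delta(\mu)=\sum\mu_{(1)}\otimes\mu_{(2)}$ for which the elements of $V$ are primitive, its counit $\epsilon$, and the projection $\pi_V:k[V]\to k[V]_1=V$. A formal loop on $V$ is a linear map $F:k[V]\otimes k[V]\cong k[V\times V]\to V$ with $F|_{k[V]\otimes 1}=\pi_V=F|_{1\otimes k[V]}$. Let $k[F]$ be the unital bialgebra whose coalgebra is $k[V]$, whose unit is $1$ and whose product is $$\mu\cdot\nu=F'(\mu\otimes\nu),\qquad F'(\omega)=\sum_{n\ge 0}\frac1{n!}F(\omega_{(1)})\cdots F(\omega_{(n)});$$ its space of primitive elements is $\mathrm{Prim}(k[F])=V$. (Shestakov--Umirbaev brackets.) In the unital free non-associative algebra on the variables $X_1,\dots,X_m,Y_1,\dots,Y_n,Z$, with the multiplicative coproduct for which the variables are primitive, let $u\backslash v$ be the left division, determined by $\sum u_{(1)}\backslash(u_{(2)}v)=\epsilon(u)v=\sum u_{(1)}(u_{(2)}\backslash v)$, and let $$p(X_1,\dots,X_m;Y_1,\dots,Y_n;Z)=\sum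 (u_{(1)}v_{(1)})\backslash (u_{(2)},v_{(2)},Z),\quad u=((X_1X_2)\cdots)X_m,\ v=((Y_1Y_2)\cdots)Y_n,$$ where $(a,b,c)=(ab)c-a(bc)$. Evaluating this polynomial in $k[F]$ gives operations $p$ on $k[F]$, and one sets $$\langle 1;y,z\rangle=-y\cdot z+z\cdot y,\qquad \langle x_1,\dots,x_m;y,z\rangle=-p(x_1,\dots,x_m;y;z)+p(x_1,\dots,x_m;z;y)\quad(m\ge1).$$ (Mikheev--Sabinin brackets.) A formal vector field is a linear map $k[V]\to V$. For $\mu\in k[V]$ and $v\in V$ put $\mu*v=F(\mu\otimes v)$ (the formal canonical connection), let $v^*$ be the formal vector field $\mu\mapsto\mu*v$, and let $\mu\otimes u\mapsto\mu\backslash^*u$ be determined by $\sum\mu_{(1)}\backslash^*(\mu_{(2)}*v)=\epsilon(\mu)v=\sum\mu_{(1)}*(\mu_{(2)}\backslash^*v)$. With products without a dot taken in the symmetric algebra, put $$\nabla_A(B)(\mu)=\sum B(\mu_{(1)}A(\mu_{(2)}))-(\mu_{(1)}A(\mu_{(2)}))*(\mu_{(3)}\backslash^*B(\mu_{(4)})),$$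 $$[A,B](\mu)=\sum B(\mu_{(1)}A(\mu_{(2)}))-A(\mu_{(1)}B(\mu_{(2)})),\qquad T(A,B)=\nabla_A(B)-\nabla_B(A)-[A,B],$$ $$\langle x_1,\dots,x_n;y,z\rangle_F=\nabla_{x_1^*}\cdots\nabla_{x_n^*}T(y^*,z^*)(1)\qquad(n\ge0).$$ Theorem. For every formal loop $F$ on $V$, every $n\ge 0$ and all $x_1,\dots,x_n,y,z\in\mathrm{Prim}(k[F])=V$, $$\langle x_1,\dots,x_n;y,z\rangle=\langle x_1,\dots,x_n;y,z\rangle_F$$ (for $n=0$ the left-hand side is $\langle 1;y,z\rangle$). -/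

import Mathlib

open scoped TensorProduct
open Coalgebra WithConv

noncomputable section

namespace SabininTheory

section Convolution

variable {k C R : Type*} [Field k] [AddCommMonoid C] [Module k C] [Ring R] [Algebra k R]

/-- Pointwise sum `c ↦ ∑ n, a n c` of a pointwise finite sequence of linear maps. -/
def locSum (a : ℕ → C →ₗ[k] R) (h : ∀ c, ∃ N, ∀ n, N ≤ n → a n c = 0) : C →ₗ[k] R where
  toFun c := ∑ᶠ n, a n c
  map_add' c d := by
    have fin : ∀ e, (Function.support fun n => a n e).Finite := fun e => by
      obtain ⟨N, hN⟩ := h e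
      refine (Set.finite_Iio N).subset fun n hn => ?_
      by_contra hlt
      exact hn (hN n (not_lt.mp hlt))
    simp only [map_add]
    exact finsum_add_distrib (fin c) (fin d)
  map_smul' r c := by
    simp only [map_smul, RingHom.id_apply]
    by_cases hr : r = 0
    · simp [hr]
    · exact (smul_finsum r _).symm

theorem locSum_apply (a : ℕ → C →ₗ[k] R) (h : ∀ c, ∃ N, ∀ n, N ≤ n → a n c = 0) (c : C)
    (N : ℕ) (hN : ∀ n, N ≤ n → a n c = 0) : locSum a h c = ∑ n ∈ Finset.range N, a n c := by
  refine finsum_eq_sum_of_support_subset _ fun n hn => ?_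
  simp only [Finset.coe_range, Set.mem_Iio]
  by_contra hlt
  exact hn (hN n (not_lt.mp hlt))

/-- A linear map that differs from the convolution unit by a pointwise nilpotent one is invertible
for the convolution product. -/
theorem isUnit_of_locNilp [Coalgebra k C] (f : WithConv (C →ₗ[k] R))
    (h : ∀ c, ∃ N, ∀ n, N ≤ n → ((1 - f) ^ n).ofConv c = 0) : IsUnit f := by
  set g : WithConv (C →ₗ[k] R) := toConv (locSum (fun n => ((1 - f) ^ n).ofConv) h) with hg
  have hgS : ∀ s : Finset C, ∃ N₀, ∀ N, N₀ ≤ N → ∀ c ∈ s,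
      g.ofConv c = (∑ n ∈ Finset.range N, (1 - f) ^ n).ofConv c := by
    intro s
    choose N hN using id h
    refine ⟨s.sup N, fun M hM c hc => ?_⟩
    have := locSum_apply _ h c M fun n hn => hN c n ((Finset.le_sup hc).trans (hM.trans hn))
    rw [hg, ofConv_toConv, this, ← LinearMap.sum_apply]
    congr 1
    exact (map_sum (WithConv.addEquiv (C →ₗ[k] R)) _ _).symm
  have key : ∀ c, (f * g).ofConv c = (1 : WithConv (C →ₗ[k] R)).ofConv c ∧
      (g * f).ofConv c = (1 : WithConv (C →ₗ[k] R)).ofConv c := by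
    classical
    intro c
    let r := ℛ k c
    obtain ⟨N₁, hN₁⟩ := h c
    obtain ⟨N₂, hN₂⟩ := hgS (r.index.image r.left ∪ r.index.image r.right)
    have hs := hN₂ (max N₁ N₂) (le_max_right _ _)
    have h0 := hN₁ (max N₁ N₂) (le_max_left _ _)
    set S := ∑ n ∈ Finset.range (max N₁ N₂), (1 - f) ^ n with hS
    have e1 : f * S = 1 - (1 - f) ^ (max N₁ N₂) := by
      have := mul_neg_geom_sum (1 - f) (max N₁ N₂)
      simpa using this
    have e2 : S * f = 1 - (1 - f) ^ (max N₁ N₂) := by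
      have := geom_sum_mul_neg (1 - f) (max N₁ N₂)
      simpa using this
    constructor
    · have : (f * g).ofConv c = (f * S).ofConv c := by
        rw [r.convMul_apply, r.convMul_apply]
        refine Finset.sum_congr rfl fun i hi => ?_
        rw [hs _ (Finset.mem_union_right _ (Finset.mem_image_of_mem _ hi))]
      rw [this, e1, ofConv_sub, LinearMap.sub_apply, h0, sub_zero]
    · have : (g * f).ofConv c = (S * f).ofConv c := by
        rw [r.convMul_apply, r.convMul_apply]
        refine Finset.sum_congr rfl fun i hi => ?_
        rw [hs _ (Finset.mem_union_left _ (Finset.mem_image_of_mem _ hi))]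
      rw [this, e2, ofConv_sub, LinearMap.sub_apply, h0, sub_zero]
  exact ⟨⟨f, g, WithConv.ext (LinearMap.ext fun c => (key c).1),
    WithConv.ext (LinearMap.ext fun c => (key c).2)⟩, rfl⟩

end Convolution

section Symmetric

variable {k V W R : Type*} [Field k] [AddCommGroup V] [Module k V] [AddCommGroup W] [Module k W]
  [Ring R] [Algebra k R]

open SymmetricAlgebra

/-- The convolution algebra of linear maps on `k[V]` is filtered by the powers of the ideal of maps
that vanish at `1`. -/
def convPow (k V R : Type*) [Field k] [AddCommGroup V] [Module k V] [Ring R] [Algebra k R] :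
    ℕ → Submodule k (WithConv (SymmetricAlgebra k V →ₗ[k] R))
  | 0 => ⊤
  | n + 1 => Submodule.span k
      {h | ∃ f g, f.ofConv 1 = 0 ∧ g ∈ convPow k V R n ∧ h = f * g}

theorem conv_apply_one (f g : WithConv (SymmetricAlgebra k V →ₗ[k] R)) :
    (f * g).ofConv 1 = f.ofConv 1 * g.ofConv 1 := by
  simp [LinearMap.convMul_def, Algebra.TensorProduct.one_def]

theorem mul_mem_convPow (n : ℕ) (h g : WithConv (SymmetricAlgebra k V →ₗ[k] R))
    (hg : g ∈ convPow k V R n) : h * g ∈ convPow k V R n := by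
  cases n with
  | zero => trivial
  | succ n =>
    induction hg using Submodule.span_induction with
    | mem x hx =>
      obtain ⟨f, g, hf, hg, rfl⟩ := hx
      refine Submodule.subset_span ⟨h * f, g, ?_, hg, (mul_assoc _ _ _).symm⟩
      rw [conv_apply_one, hf, mul_zero]
    | zero => rw [mul_zero]; exact zero_mem _
    | add x y _ _ hx hy => rw [mul_add]; exact add_mem hx hy
    | smul a x _ hx => rw [mul_smul_comm]; exact Submodule.smul_mem _ _ hx

theorem pow_mem_convPow (f : WithConv (SymmetricAlgebra k V →ₗ[k] R)) (hf : f.ofConv 1 = 0)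
    (n : ℕ) : f ^ n ∈ convPow k V R n := by
  induction n with
  | zero => trivial
  | succ n ih => rw [pow_succ']; exact Submodule.subset_span ⟨f, _, hf, ih, rfl⟩

theorem convPow_succ_le (n : ℕ) : convPow k V R (n + 1) ≤ convPow k V R n := by
  refine Submodule.span_le.mpr ?_
  rintro _ ⟨f, g, -, hg, rfl⟩
  exact mul_mem_convPow n f g hg

theorem convPow_antitone : Antitone (convPow k V R) := antitone_nat_of_succ_le convPow_succ_le

/-- The derivation of the convolution algebra dual to multiplication by `v`. -/
def convDer (v : V) (f : WithConv (SymmetricAlgebra k V →ₗ[k] R)) :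
    WithConv (SymmetricAlgebra k V →ₗ[k] R) :=
  toConv (f.ofConv ∘ₗ LinearMap.mulLeft k (ι k V v))

theorem convDer_mul (v : V) (f g : WithConv (SymmetricAlgebra k V →ₗ[k] R)) :
    convDer v (f * g) = convDer v f * g + f * convDer v g := by
  refine WithConv.ext (LinearMap.ext fun c => ?_)
  have e := (ℛ k c).eq
  rw [ofConv_add, LinearMap.add_apply, (ℛ k c).convMul_apply, (ℛ k c).convMul_apply,
    ← Finset.sum_add_distrib]
  simp only [convDer, LinearMap.comp_apply, LinearMap.mulLeft_apply, LinearMap.convMul_def,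
    Bialgebra.comul_mul, comul_ι]
  rw [← e]
  simp [add_mul, Finset.mul_sum, Finset.sum_add_distrib]

theorem convDer_mem (v : V) (n : ℕ) : ∀ g ∈ convPow k V R (n + 1), convDer v g ∈ convPow k V R n := by
  induction n with
  | zero => intro g _; trivial
  | succ n ih =>
    intro g hg
    induction hg using Submodule.span_induction with
    | mem x hx =>
      obtain ⟨f, g, hf, hg, rfl⟩ := hx
      rw [convDer_mul]
      exact add_mem (mul_mem_convPow _ _ _ hg) (Submodule.subset_span ⟨f, _, hf, ih g hg, rfl⟩)
    | zero =>
      have : convDer v (0 : WithConv (SymmetricAlgebra k V →ₗ[k] R)) = 0 := by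
        simp [convDer]
      rw [this]; exact zero_mem _
    | add x y _ _ hx hy =>
      have : convDer v (x + y) = convDer v x + convDer v y := by
        simp [convDer, LinearMap.add_comp]
      rw [this]; exact add_mem hx hy
    | smul a x _ hx =>
      have : convDer v (a • x) = a • convDer v x := by
        simp [convDer, LinearMap.smul_comp]
      rw [this]; exact Submodule.smul_mem _ _ hx

theorem exists_convPow_apply_eq_zero (c : SymmetricAlgebra k V) :
    ∃ N, ∀ g ∈ convPow k V R N, g.ofConv c = 0 := by
  suffices H : ∀ b, (∃ N, ∀ g ∈ convPow k V R N, g.ofConv b = 0) →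
      ∃ N, ∀ g ∈ convPow k V R N, g.ofConv (c * b) = 0 by
    rw [← mul_one c]
    refine H 1 ⟨1, fun g hg => ?_⟩
    induction hg using Submodule.span_induction with
    | mem x hx =>
      obtain ⟨f, g, hf, -, rfl⟩ := hx
      rw [conv_apply_one, hf, zero_mul]
    | zero => simp
    | add x y _ _ hx hy => simp [hx, hy]
    | smul a x _ hx => simp [hx]
  induction c using SymmetricAlgebra.induction with
  | algebraMap r =>
    rintro b ⟨N, hN⟩
    exact ⟨N, fun g hg => by rw [← Algebra.smul_def, map_smul, hN g hg, smul_zero]⟩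
  | ι v =>
    rintro b ⟨N, hN⟩
    exact ⟨N + 1, fun g hg => hN _ (convDer_mem v N g hg)⟩
  | mul a b ha hb =>
    intro c hc
    rw [mul_assoc]
    exact ha _ (hb _ hc)
  | add a b ha hb =>
    intro c hc
    obtain ⟨N, hN⟩ := ha c hc
    obtain ⟨M, hM⟩ := hb c hc
    refine ⟨max N M, fun g hg => ?_⟩
    rw [add_mul, map_add, hN g (convPow_antitone (le_max_left _ _) hg),
      hM g (convPow_antitone (le_max_right _ _) hg), add_zero]

theorem conv_pow_locNilp (f : WithConv (SymmetricAlgebra k V →ₗ[k] R)) (hf : f.ofConv 1 = 0)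
    (c : SymmetricAlgebra k V) : ∃ N, ∀ n, N ≤ n → (f ^ n).ofConv c = 0 := by
  obtain ⟨N, hN⟩ := exists_convPow_apply_eq_zero (R := R) c
  exact ⟨N, fun n hn => hN _ (convPow_antitone hn (pow_mem_convPow f hf n))⟩

/-- The projection `π_V : k[V] → V` onto the component `k[V]_1 = V`. -/
def proj (k V : Type*) [Field k] [AddCommGroup V] [Module k V] : SymmetricAlgebra k V →ₗ[k] V :=
  letI : Module kᵐᵒᵖ V := Module.compHom V ((RingHom.id k).fromOpposite mul_comm)
  haveI : IsCentralScalar k V := ⟨fun _ _ => rfl⟩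
  TrivSqZeroExt.sndHom k V ∘ₗ (lift (TrivSqZeroExt.inrHom k V)).toLinearMap

theorem proj_ι (v : V) : proj k V (ι k V v) = v := by
  simp [proj]

theorem proj_one : proj k V 1 = 0 := by
  let _ : Module kᵐᵒᵖ V := Module.compHom V ((RingHom.id k).fromOpposite mul_comm)
  have _ : IsCentralScalar k V := ⟨fun _ _ => rfl⟩
  change (lift (TrivSqZeroExt.inrHom k V) 1).snd = 0
  rw [map_one, TrivSqZeroExt.snd_one]

theorem proj_mul (a b : SymmetricAlgebra k V) :
    proj k V (a * b) = counit (R := k) a • proj k V b + counit (R := k) b • proj k V a := by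
  let _ : Module kᵐᵒᵖ V := Module.compHom V ((RingHom.id k).fromOpposite mul_comm)
  have _ : IsCentralScalar k V := ⟨fun _ _ => rfl⟩
  have h : (TrivSqZeroExt.fstHom k k V).comp (lift (TrivSqZeroExt.inrHom k V)) =
      Bialgebra.counitAlgHom k (SymmetricAlgebra k V) := by
    ext v
    simp [algebraMapInv_ι]
  have h' : ∀ c, (lift (TrivSqZeroExt.inrHom k V) c).fst = counit (R := k) c :=
    fun c => DFunLike.congr_fun h c
  simp only [proj, LinearMap.comp_apply, AlgHom.toLinearMap_apply, map_mul,
    TrivSqZeroExt.sndHom_apply, TrivSqZeroExt.snd_mul, h']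
  rfl

end Symmetric

section FormalMaps

variable (k : Type*) [Field k] (V W : Type*) [AddCommGroup V] [Module k V]
  [AddCommGroup W] [Module k W]

/-- A formal map from `V` to `W`: a linear map `k[V] → W` that sends `1` to `0`. -/
structure FormalMap where
  toLin : SymmetricAlgebra k V →ₗ[k] W
  map_one : toLin 1 = 0

variable {k V W}

theorem FormalMap.ι_comp_locNilp (θ : FormalMap k V W) (c : SymmetricAlgebra k V) :
    ∃ N, ∀ n, N ≤ n → ((n.factorial : k)⁻¹ •
      (toConv (SymmetricAlgebra.ι k W ∘ₗ θ.toLin) ^ n).ofConv) c = 0 := by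
  obtain ⟨N, hN⟩ := conv_pow_locNilp (toConv (SymmetricAlgebra.ι k W ∘ₗ θ.toLin))
    (by simp [θ.map_one]) c
  exact ⟨N, fun n hn => by rw [LinearMap.smul_apply, hN n hn, smul_zero]⟩

/-- The map `θ' : k[V] → k[W]` induced by a formal map `θ`,
`θ'(μ) = ∑ₙ (1/n!) θ(μ₍₁₎) ⋯ θ(μ₍ₙ₎)`. -/
def FormalMap.induced (θ : FormalMap k V W) : SymmetricAlgebra k V →ₗ[k] SymmetricAlgebra k W :=
  locSum (fun n => (n.factorial : k)⁻¹ •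
    (toConv (SymmetricAlgebra.ι k W ∘ₗ θ.toLin) ^ n).ofConv) θ.ι_comp_locNilp

/-- The algebra map `k[V] → k[W]` induced by a linear map `V → W`. -/
def symMap (f : V →ₗ[k] W) : SymmetricAlgebra k V →ₐ[k] SymmetricAlgebra k W :=
  SymmetricAlgebra.lift (SymmetricAlgebra.ι k W ∘ₗ f)

variable (k V)

/-- The canonical isomorphism `k[V] ⊗ k[V] ≅ k[V × V]`, as a bilinear map. -/
def tensorToProd : SymmetricAlgebra k V →ₗ[k] SymmetricAlgebra k V →ₗ[k]
    SymmetricAlgebra k (V × V) :=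
  (LinearMap.mul k (SymmetricAlgebra k (V × V))).compl₁₂
    (symMap (LinearMap.inl k V V)).toLinearMap (symMap (LinearMap.inr k V V)).toLinearMap

/-- A formal loop (unital formal multiplication) on `V`: a formal map `F : k[V × V] → V` whose
restrictions to `k[V] ⊗ 1` and to `1 ⊗ k[V]` are the projection `π_V`. -/
structure FormalLoop extends FormalMap k (V × V) V where
  mul_unit : ∀ μ, toLin (tensorToProd k V μ 1) = proj k V μ
  unit_mul : ∀ μ, toLin (tensorToProd k V 1 μ) = proj k V μ

variable {k V}

/-- The product `μ · ν = F'(μ ⊗ ν)` of the bialgebra `k[F]`, whose underlying coalgebra is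
`k[V]` and whose unit is `1`. -/
def FormalLoop.prod (F : FormalLoop k V) :
    SymmetricAlgebra k V →ₗ[k] SymmetricAlgebra k V →ₗ[k] SymmetricAlgebra k V :=
  (tensorToProd k V).compr₂ F.induced

/-- Primitive elements of `k[V]`, that is, the elements of `Prim(k[F])`. -/
def IsPrim (μ : SymmetricAlgebra k V) : Prop :=
  comul (R := k) μ = μ ⊗ₜ[k] 1 + 1 ⊗ₜ[k] μ

end FormalMaps

section Connections

variable {k : Type*} [Field k] {V : Type*} [AddCommGroup V] [Module k V]

/-- For a formal vector field `A : k[V] → V`, the map `μ ↦ ∑ μ₍₁₎ A(μ₍₂₎)` (product of the symmetric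
algebra). The derivation `f ↦ A(f)` of formal functions is composition with it. -/
def shift (A : SymmetricAlgebra k V →ₗ[k] V) : SymmetricAlgebra k V →ₗ[k] SymmetricAlgebra k V :=
  LinearMap.mul' k (SymmetricAlgebra k V) ∘ₗ
    LinearMap.lTensor (SymmetricAlgebra k V) (SymmetricAlgebra.ι k V ∘ₗ A) ∘ₗ comul

/-- The Lie bracket of formal vector fields,
`[A, B](μ) = ∑ B(μ₍₁₎ A(μ₍₂₎)) - A(μ₍₁₎ B(μ₍₂₎))`. -/
def fieldBracket (A B : SymmetricAlgebra k V →ₗ[k] V) : SymmetricAlgebra k V →ₗ[k] V :=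
  B ∘ₗ shift A - A ∘ₗ shift B

/-- `μ ↦ ∑ f(μ₍₁₎)(A(μ₍₂₎))`. -/
def convAct (f : SymmetricAlgebra k V →ₗ[k] Module.End k V) (A : SymmetricAlgebra k V →ₗ[k] V) :
    SymmetricAlgebra k V →ₗ[k] V :=
  TensorProduct.lift f ∘ₗ LinearMap.lTensor (SymmetricAlgebra k V) A ∘ₗ comul

variable (k V) in
/-- A formal flat affine connection: a linear map `k[V] ⊗ V → V`, `μ ⊗ v ↦ μ * v`, whose restriction
to `1 ⊗ V` is the identity. Here `toLin μ` is the endomorphism `v ↦ μ * v`. -/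
structure FlatConnection where
  toLin : SymmetricAlgebra k V →ₗ[k] Module.End k V
  map_one : toLin 1 = 1

namespace FlatConnection

variable (Γ : FlatConnection k V)

theorem isUnit : IsUnit (toConv Γ.toLin) :=
  isUnit_of_locNilp _ fun c => conv_pow_locNilp _ (by simp [Γ.map_one]) c

/-- The inverse map `μ ⊗ u ↦ μ \* u`, determined by
`∑ μ₍₁₎ \* (μ₍₂₎ * v) = ε(μ) v = ∑ μ₍₁₎ * (μ₍₂₎ \* v)`: the inverse of `μ ↦ (v ↦ μ * v)` for the
convolution product of maps `k[V] → End(V)`. -/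
def ldiv : SymmetricAlgebra k V →ₗ[k] Module.End k V :=
  (Ring.inverse (toConv Γ.toLin)).ofConv

theorem ldiv_mul : toConv Γ.ldiv * toConv Γ.toLin = 1 := Ring.inverse_mul_cancel _ Γ.isUnit

theorem mul_ldiv : toConv Γ.toLin * toConv Γ.ldiv = 1 := Ring.mul_inverse_cancel _ Γ.isUnit

/-- The vector field `v^* : μ ↦ μ * v` adapted to the tangent vector `v`. -/
def adapted (v : V) : SymmetricAlgebra k V →ₗ[k] V := Γ.toLin.flip v

/-- The covariant derivative
`∇_A(B)(μ) = ∑ B(μ₍₁₎ A(μ₍₂₎)) - (μ₍₁₎ A(μ₍₂₎)) * (μ₍₃₎ \* B(μ₍₄₎))`. -/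
def nabla (A B : SymmetricAlgebra k V →ₗ[k] V) : SymmetricAlgebra k V →ₗ[k] V :=
  B ∘ₗ shift A - convAct (Γ.toLin ∘ₗ shift A) (convAct Γ.ldiv B)

/-- The torsion `T(A, B) = ∇_A(B) - ∇_B(A) - [A, B]`. -/
def torsion (A B : SymmetricAlgebra k V →ₗ[k] V) : SymmetricAlgebra k V →ₗ[k] V :=
  Γ.nabla A B - Γ.nabla B A - fieldBracket A B

end FlatConnection

/-- The formal canonical connection of a formal loop `F`: the restriction of `F` to
`k[V] ⊗ V ⊂ k[V] ⊗ k[V]`. -/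
def FormalLoop.connection (F : FormalLoop k V) : FlatConnection k V where
  toLin := ((tensorToProd k V).compr₂ F.toLin).compl₂ (SymmetricAlgebra.ι k V)
  map_one := by
    refine LinearMap.ext fun v => ?_
    exact (F.unit_mul _).trans (proj_ι v)

/-- The Mikheev-Sabinin operations
`⟨x₁, …, xₙ; y, z⟩_F = ∇_{x₁^*} ⋯ ∇_{xₙ^*} T(y^*, z^*) (1)`. -/
def FormalLoop.msBracket (F : FormalLoop k V) {n : ℕ} (x : Fin n → V) (y z : V) : V :=
  (List.ofFn x).foldr (fun v A => F.connection.nabla (F.connection.adapted v) A)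
    (F.connection.torsion (F.connection.adapted y) (F.connection.adapted z)) 1

end Connections

section FreeAlgebra

variable (k : Type*) [Field k] (S : Type*)

/-- The unital free non-associative algebra `k{S}`: its basis consists of `1` and of the
non-associative monomials in the elements of `S`. -/
def FreeAlg := MonoidAlgebra k (WithOne (FreeMagma S))

namespace FreeAlg

instance : NonAssocRing (FreeAlg k S) :=
  inferInstanceAs (NonAssocRing (MonoidAlgebra k (WithOne (FreeMagma S))))
instance : Module k (FreeAlg k S) :=
  inferInstanceAs (Module k (MonoidAlgebra k (WithOne (FreeMagma S))))
instance : IsScalarTower k (FreeAlg k S) (FreeAlg k S) :=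
  inferInstanceAs (IsScalarTower k (MonoidAlgebra k (WithOne (FreeMagma S)))
    (MonoidAlgebra k (WithOne (FreeMagma S))))
instance : SMulCommClass k (FreeAlg k S) (FreeAlg k S) :=
  inferInstanceAs (SMulCommClass k (MonoidAlgebra k (WithOne (FreeMagma S)))
    (MonoidAlgebra k (WithOne (FreeMagma S))))

variable {S}

/-- The monomial `w` as an element of `k{S}`. -/
def mono (w : WithOne (FreeMagma S)) : FreeAlg k S := MonoidAlgebra.single w 1

/-- The generator `s`. -/
def gen (s : S) : FreeAlg k S := mono k (FreeMagma.of s : FreeMagma S)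

theorem mono_one : mono k (1 : WithOne (FreeMagma S)) = 1 := rfl

theorem mono_mul (v w : WithOne (FreeMagma S)) : mono k (v * w) = mono k v * mono k w := by
  have := MonoidAlgebra.single_mul_single (R := k) (m₁ := v) (m₂ := w) (r₁ := 1) (r₂ := 1)
  rw [mul_one] at this
  exact this.symm

variable {k} {N : Type*} [AddCommMonoid N] [Module k N]

/-- The linear map with prescribed values on the monomials. -/
def extend (g : WithOne (FreeMagma S) → N) : FreeAlg k S →ₗ[k] N :=
  Finsupp.linearCombination k g ∘ₗ
    (MonoidAlgebra.coeffLinearEquiv (S := k) (M := WithOne (FreeMagma S)) k).toLinearMap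

theorem extend_mono (g : WithOne (FreeMagma S) → N) (w : WithOne (FreeMagma S)) :
    extend g (mono k w) = g w := by
  change Finsupp.linearCombination k g (Finsupp.single w 1) = g w
  simp

/-- The degree of a monomial. -/
def deg (w : WithOne (FreeMagma S)) : ℕ :=
  WithOne.recOneCoe (motive := fun _ => ℕ) 0 FreeMagma.length w

theorem deg_mul (v w : WithOne (FreeMagma S)) : deg (v * w) = deg v + deg w := by
  induction v using WithOne.recOneCoe with
  | one => rw [one_mul]; exact (Nat.zero_add _).symm
  | coe t =>
    induction w using WithOne.recOneCoe with
    | one => rw [mul_one]; exact (Nat.add_zero _).symm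
    | coe u => rfl

theorem eq_one_of_deg {w : WithOne (FreeMagma S)} (h : deg w = 0) : w = 1 := by
  induction w using WithOne.recOneCoe with
  | one => rfl
  | coe t => exact absurd h (FreeMagma.length_pos t).ne'

theorem induction {P : FreeAlg k S → Prop} (a : FreeAlg k S) (hm : ∀ w, P (mono k w))
    (ha : ∀ a b, P a → P b → P (a + b)) (hs : ∀ (r : k) a, P a → P (r • a)) : P a := by
  refine MonoidAlgebra.induction_linear (motive := P) a ?_ ha fun w r => ?_
  · have := hs 0 _ (hm 1)
    rwa [zero_smul] at this
  · have := hs r _ (hm w)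
    have e : r • mono k w = MonoidAlgebra.single w r := by
      refine (MonoidAlgebra.smul_single r w (1 : k)).trans ?_
      rw [smul_eq_mul, mul_one]
    rwa [e] at this

theorem hom_ext {f g : FreeAlg k S →ₗ[k] N} (h : ∀ w, f (mono k w) = g (mono k w)) : f = g := by
  refine LinearMap.ext fun a => ?_
  induction a using FreeAlg.induction with
  | hm w => exact h w
  | ha a b ha hb => rw [map_add, map_add, ha, hb]
  | hs r a ha => rw [map_smul, map_smul, ha]

/-- The linear extension of a multiplicative map on monomials is multiplicative. -/
theorem extend_mul {N : Type*} [NonAssocSemiring N] [Module k N] [IsScalarTower k N N]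
    [SMulCommClass k N N] (g : WithOne (FreeMagma S) →* N) (a b : FreeAlg k S) :
    extend (k := k) g (a * b) = extend (k := k) g a * extend (k := k) g b := by
  induction a using FreeAlg.induction with
  | hm v =>
    induction b using FreeAlg.induction with
    | hm w => rw [← mono_mul, extend_mono, extend_mono, extend_mono, map_mul]
    | ha a b ha hb => rw [mul_add, map_add, map_add, ha, hb, mul_add]
    | hs r a ha => rw [mul_smul_comm, map_smul, map_smul, ha, mul_smul_comm]
  | ha a b ha hb => rw [add_mul, map_add, map_add, ha, hb, add_mul]
  | hs r a ha => rw [smul_mul_assoc, map_smul, map_smul, ha, smul_mul_assoc]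

/-- The coproduct on monomials: multiplicative, with primitive generators. -/
def comulMono : WithOne (FreeMagma S) →* FreeAlg k S ⊗[k] FreeAlg k S :=
  WithOne.lift (FreeMagma.lift fun s => gen k s ⊗ₜ[k] 1 + 1 ⊗ₜ[k] gen k s)

/-- The counit on monomials: multiplicative, and `0` on generators. -/
def counitMono : WithOne (FreeMagma S) →* k :=
  WithOne.lift (FreeMagma.lift fun _ => 0)

instance : CoalgebraStruct k (FreeAlg k S) where
  comul := extend (k := k) comulMono
  counit := extend (k := k) counitMono

theorem comul_mul (a b : FreeAlg k S) : comul (R := k) (a * b) = comul (R := k) a * comul b :=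
  extend_mul comulMono a b

theorem counit_mul (a b : FreeAlg k S) :
    counit (R := k) (a * b) = counit (R := k) a * counit (R := k) b :=
  extend_mul counitMono a b

theorem comul_one : comul (R := k) (1 : FreeAlg k S) = 1 ⊗ₜ 1 := by
  rw [← mono_one]
  exact (extend_mono _ _).trans (map_one comulMono)

theorem counit_one : counit (R := k) (1 : FreeAlg k S) = 1 := by
  rw [← mono_one]
  exact (extend_mono _ _).trans (map_one counitMono)

theorem comul_gen (s : S) :
    comul (R := k) (gen k s) = gen k s ⊗ₜ[k] 1 + 1 ⊗ₜ[k] gen k s :=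
  extend_mono _ _

theorem counit_gen (s : S) : counit (R := k) (gen k s) = 0 :=
  extend_mono _ _

theorem monoid_induction {P : FreeAlg k S → Prop} (h1 : P 1) (hg : ∀ s, P (gen k s))
    (hm : ∀ a b, P a → P b → P (a * b)) (w : WithOne (FreeMagma S)) : P (mono k w) := by
  induction w using WithOne.recOneCoe with
  | one => exact h1
  | coe t =>
    induction t using FreeMagma.recOnMul with
    | ih1 s => exact hg s
    | ih2 x y hx hy =>
      rw [WithOne.coe_mul, mono_mul]
      exact hm _ _ hx hy

/-- Two linear maps out of `k{S}` that are multiplicative and agree on generators are equal. -/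
theorem mulHom_ext {N : Type*} [NonAssocSemiring N] [Module k N] {f g : FreeAlg k S →ₗ[k] N}
    (hf : ∀ a b, f (a * b) = f a * f b) (hg : ∀ a b, g (a * b) = g a * g b)
    (h1 : f 1 = g 1) (h : ∀ s, f (gen k s) = g (gen k s)) : f = g := by
  refine hom_ext fun w => ?_
  refine monoid_induction (P := fun a => f a = g a) h1 h (fun a b ha hb => ?_) w
  rw [hf, hg, ha, hb]

theorem rTensor_mul {A A' : Type*} [NonAssocSemiring A] [Module k A] [IsScalarTower k A A]
    [SMulCommClass k A A] [NonAssocSemiring A'] [Module k A'] [IsScalarTower k A' A']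
    [SMulCommClass k A' A'] (f : A →ₗ[k] A') (hf : ∀ a b, f (a * b) = f a * f b)
    (x y : A ⊗[k] FreeAlg k S) :
    f.rTensor (FreeAlg k S) (x * y) = f.rTensor (FreeAlg k S) x * f.rTensor (FreeAlg k S) y := by
  induction x using TensorProduct.induction_on with
  | zero => simp
  | add x x' hx hx' => rw [add_mul, map_add, map_add, hx, hx', add_mul]
  | tmul a b =>
    induction y using TensorProduct.induction_on with
    | zero => simp
    | add x x' hx hx' => rw [mul_add, map_add, map_add, hx, hx', mul_add]
    | tmul a' b' => simp [hf]

theorem lTensor_mul {A A' : Type*} [NonAssocSemiring A] [Module k A] [IsScalarTower k A A]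
    [SMulCommClass k A A] [NonAssocSemiring A'] [Module k A'] [IsScalarTower k A' A']
    [SMulCommClass k A' A'] (f : A →ₗ[k] A') (hf : ∀ a b, f (a * b) = f a * f b)
    (x y : FreeAlg k S ⊗[k] A) :
    f.lTensor (FreeAlg k S) (x * y) = f.lTensor (FreeAlg k S) x * f.lTensor (FreeAlg k S) y := by
  induction x using TensorProduct.induction_on with
  | zero => simp
  | add x x' hx hx' => rw [add_mul, map_add, map_add, hx, hx', add_mul]
  | tmul a b =>
    induction y using TensorProduct.induction_on with
    | zero => simp
    | add x x' hx hx' => rw [mul_add, map_add, map_add, hx, hx', mul_add]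
    | tmul a' b' => simp [hf]

theorem assoc_mul (x y : (FreeAlg k S ⊗[k] FreeAlg k S) ⊗[k] FreeAlg k S) :
    TensorProduct.assoc k (FreeAlg k S) (FreeAlg k S) (FreeAlg k S) (x * y) =
      TensorProduct.assoc k (FreeAlg k S) (FreeAlg k S) (FreeAlg k S) x *
      TensorProduct.assoc k (FreeAlg k S) (FreeAlg k S) (FreeAlg k S) y := by
  induction x using TensorProduct.induction_on with
  | zero => simp
  | add x x' hx hx' => rw [add_mul, map_add, map_add, hx, hx', add_mul]
  | tmul p c =>
    induction y using TensorProduct.induction_on with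
    | zero => simp
    | add x x' hx hx' => rw [mul_add, map_add, map_add, hx, hx', mul_add]
    | tmul q d =>
      induction p using TensorProduct.induction_on with
      | zero => simp
      | add x x' hx hx' =>
        simp only [TensorProduct.add_tmul, add_mul, map_add, hx, hx']
      | tmul a b =>
        induction q using TensorProduct.induction_on with
        | zero => simp
        | add x x' hx hx' =>
          simp only [TensorProduct.add_tmul, mul_add, map_add, hx, hx']
        | tmul a' b' => simp

instance : Coalgebra k (FreeAlg k S) where
  coassoc := by
    refine mulHom_ext (k := k) (S := S)
      (N := FreeAlg k S ⊗[k] (FreeAlg k S ⊗[k] FreeAlg k S)) (fun a b => ?_) (fun a b => ?_) ?_ fun s => ?_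
    · simp only [LinearMap.comp_apply, comul_mul]
      rw [rTensor_mul (A := FreeAlg k S) (A' := FreeAlg k S ⊗[k] FreeAlg k S) comul comul_mul,
        LinearEquiv.coe_coe, assoc_mul]
    · simp only [LinearMap.comp_apply, comul_mul]
      rw [lTensor_mul (A := FreeAlg k S) (A' := FreeAlg k S ⊗[k] FreeAlg k S) comul comul_mul]
    · simp [comul_one]
    · simp [comul_gen, comul_one, TensorProduct.add_tmul, TensorProduct.tmul_add]
      abel
  rTensor_counit_comp_comul := by
    refine mulHom_ext (fun a b => ?_) (fun a b => ?_) ?_ fun s => ?_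
    · simp only [LinearMap.comp_apply, comul_mul]
      rw [rTensor_mul (A := FreeAlg k S) (A' := k) counit counit_mul]
    · simp
    · simp [comul_one, counit_one]
    · simp [comul_gen, counit_one, counit_gen]
  lTensor_counit_comp_comul := by
    refine mulHom_ext (fun a b => ?_) (fun a b => ?_) ?_ fun s => ?_
    · simp only [LinearMap.comp_apply, comul_mul]
      rw [lTensor_mul (A := FreeAlg k S) (A' := k) counit counit_mul]
    · simp
    · simp [comul_one, counit_one]
    · simp [comul_gen, counit_one, counit_gen]

/-- Pure tensors of monomials of total degree `d`. -/
def bideg (k S : Type*) [Field k] (d : ℕ) : Submodule k (FreeAlg k S ⊗[k] FreeAlg k S) :=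
  Submodule.span k {x | ∃ v w : WithOne (FreeMagma S), deg v + deg w = d ∧
    x = mono k v ⊗ₜ mono k w}

theorem bideg_mul (c d : ℕ) (x y : FreeAlg k S ⊗[k] FreeAlg k S) (hx : x ∈ bideg k S c)
    (hy : y ∈ bideg k S d) : x * y ∈ bideg k S (c + d) := by
  induction hx using Submodule.span_induction with
  | zero => rw [zero_mul]; exact zero_mem _
  | add a b _ _ ha hb => rw [add_mul]; exact add_mem ha hb
  | smul r a _ ha => rw [smul_mul_assoc]; exact Submodule.smul_mem _ _ ha
  | mem x hx =>
    obtain ⟨v, w, h, rfl⟩ := hx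
    induction hy using Submodule.span_induction with
    | zero => rw [mul_zero]; exact zero_mem _
    | add a b _ _ ha hb => rw [mul_add]; exact add_mem ha hb
    | smul r a _ ha => rw [mul_smul_comm]; exact Submodule.smul_mem _ _ ha
    | mem y hy =>
      obtain ⟨v', w', h', rfl⟩ := hy
      refine Submodule.subset_span ⟨v * v', w * w', ?_, ?_⟩
      · rw [deg_mul, deg_mul]; omega
      · rw [Algebra.TensorProduct.tmul_mul_tmul, mono_mul, mono_mul]

theorem comul_mono_mem (w : WithOne (FreeMagma S)) :
    comul (R := k) (mono k w) ∈ bideg k S (deg w) := by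
  induction w using WithOne.recOneCoe with
  | one =>
    rw [mono_one, comul_one]
    exact Submodule.subset_span ⟨1, 1, rfl, rfl⟩
  | coe t =>
    induction t using FreeMagma.recOnMul with
    | ih1 s =>
      change comul (R := k) (gen k s) ∈ _
      rw [comul_gen]
      exact add_mem (Submodule.subset_span ⟨_, 1, rfl, rfl⟩)
        (Submodule.subset_span ⟨1, _, rfl, rfl⟩)
    | ih2 x y hx hy =>
      rw [WithOne.coe_mul, mono_mul, comul_mul, deg_mul]
      exact bideg_mul _ _ _ _ hx hy

theorem conv_pow_mono {R : Type*} [Ring R] [Algebra k R] (f : WithConv (FreeAlg k S →ₗ[k] R))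
    (hf : f.ofConv 1 = 0) (n : ℕ) (w : WithOne (FreeMagma S)) (hn : deg w < n) :
    (f ^ n).ofConv (mono k w) = 0 := by
  induction n generalizing w with
  | zero => omega
  | succ n ih =>
    have : ∀ x ∈ bideg k S (deg w),
        LinearMap.mul' k R (TensorProduct.map f.ofConv (f ^ n).ofConv x) = 0 := by
      intro x hx
      induction hx using Submodule.span_induction with
      | zero => simp
      | add a b _ _ ha hb => rw [map_add, map_add, ha, hb, add_zero]
      | smul r a _ ha => rw [map_smul, map_smul, ha, smul_zero]
      | mem x hx =>
        obtain ⟨v, u, h, rfl⟩ := hx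
        rw [TensorProduct.map_tmul, LinearMap.mul'_apply]
        by_cases hv : deg v = 0
        · rw [eq_one_of_deg hv, mono_one, hf, zero_mul]
        · rw [ih u (by omega), mul_zero]
    rw [pow_succ']
    exact this _ (comul_mono_mem w)

theorem conv_pow_locNilp {R : Type*} [Ring R] [Algebra k R] (f : WithConv (FreeAlg k S →ₗ[k] R))
    (hf : f.ofConv 1 = 0) (c : FreeAlg k S) : ∃ N, ∀ n, N ≤ n → (f ^ n).ofConv c = 0 := by
  induction c using FreeAlg.induction with
  | hm w => exact ⟨deg w + 1, fun n hn => conv_pow_mono f hf n w hn⟩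
  | ha a b ha hb =>
    obtain ⟨N, hN⟩ := ha
    obtain ⟨M, hM⟩ := hb
    refine ⟨max N M, fun n hn => ?_⟩
    rw [map_add, hN n ((le_max_left _ _).trans hn), hM n ((le_max_right _ _).trans hn), add_zero]
  | hs r a ha =>
    obtain ⟨N, hN⟩ := ha
    exact ⟨N, fun n hn => by rw [map_smul, hN n hn, smul_zero]⟩

end FreeAlg
end FreeAlgebra

section PrimitiveOperations

namespace FreeAlg

variable {k : Type*} [Field k] {S : Type*}

theorem isUnit_mul : IsUnit (toConv (LinearMap.mul k (FreeAlg k S) :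
    FreeAlg k S →ₗ[k] Module.End k (FreeAlg k S))) := by
  refine isUnit_of_locNilp _ fun c => conv_pow_locNilp _ ?_ c
  refine LinearMap.ext fun a => ?_
  have h1 : (1 : WithConv (FreeAlg k S →ₗ[k] Module.End k (FreeAlg k S))).ofConv 1 = 1 := by
    change algebraMap k _ (counit (R := k) (1 : FreeAlg k S)) = 1
    rw [counit_one, map_one]
  rw [ofConv_sub, LinearMap.sub_apply, h1]
  simp

/-- The left division `u \ v` of `k{S}`, determined by
`∑ u₍₁₎ \ (u₍₂₎ v) = ε(u) v = ∑ u₍₁₎ (u₍₂₎ \ v)`: the inverse of `u ↦ (v ↦ u v)` for the convolution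
product of maps `k{S} → End(k{S})`. -/
def ldiv : FreeAlg k S →ₗ[k] FreeAlg k S →ₗ[k] FreeAlg k S :=
  (Ring.inverse (toConv (LinearMap.mul k (FreeAlg k S) :
    FreeAlg k S →ₗ[k] Module.End k (FreeAlg k S)))).ofConv

theorem ldiv_mul : toConv (ldiv : FreeAlg k S →ₗ[k] Module.End k (FreeAlg k S)) *
    toConv (LinearMap.mul k (FreeAlg k S) : FreeAlg k S →ₗ[k] Module.End k (FreeAlg k S)) = 1 :=
  Ring.inverse_mul_cancel _ isUnit_mul

theorem mul_ldiv : toConv (LinearMap.mul k (FreeAlg k S) :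
      FreeAlg k S →ₗ[k] Module.End k (FreeAlg k S)) *
    toConv (ldiv : FreeAlg k S →ₗ[k] Module.End k (FreeAlg k S)) = 1 :=
  Ring.mul_inverse_cancel _ isUnit_mul

/-- The associator `a ⊗ b ↦ (a, b, z) = (a b) z - a (b z)`. -/
def assoc (z : FreeAlg k S) : FreeAlg k S ⊗[k] FreeAlg k S →ₗ[k] FreeAlg k S :=
  LinearMap.mulRight k z ∘ₗ LinearMap.mul' k (FreeAlg k S) -
    LinearMap.mul' k (FreeAlg k S) ∘ₗ LinearMap.lTensor (FreeAlg k S) (LinearMap.mulRight k z)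

/-- `p(u, v, z) = ∑ (u₍₁₎ v₍₁₎) \ (u₍₂₎, v₍₂₎, z)` in `k{S}`. The coproduct of `u ⊗ v` is
`∑ (u₍₁₎ ⊗ v₍₁₎) ⊗ (u₍₂₎ ⊗ v₍₂₎)`. -/
def pOp (u v z : FreeAlg k S) : FreeAlg k S :=
  TensorProduct.lift ldiv (TensorProduct.map (LinearMap.mul' k (FreeAlg k S)) (assoc z)
    (comul (R := k) (u ⊗ₜ[k] v)))

variable (k) in
/-- The monomial `((s₁ s₂) ⋯) sₘ`. -/
def leftNormed {m : ℕ} (s : Fin m → S) : FreeAlg k S :=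
  (List.ofFn s).foldl (fun a t => a * gen k t) 1

/-- The value of a non-associative monomial under the substitution `s ↦ a s` in a space `A` with a
product `mul`. -/
def evalTree {A : Type*} [AddCommGroup A] [Module k A] (mul : A →ₗ[k] A →ₗ[k] A) (a : S → A) :
    FreeMagma S → A
  | FreeMagma.of s => a s
  | FreeMagma.mul t t' => mul (evalTree mul a t) (evalTree mul a t')

/-- The value of a non-associative polynomial under the substitution `s ↦ a s` in the algebra `A`
with product `mul` and unit `one`. -/
def eval {A : Type*} [AddCommGroup A] [Module k A] (mul : A →ₗ[k] A →ₗ[k] A) (one : A)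
    (a : S → A) : FreeAlg k S →ₗ[k] A :=
  extend (WithOne.recOneCoe one (evalTree mul a))

end FreeAlg

variable {k : Type*} [Field k] {A : Type*} [AddCommGroup A] [Module k A]

/-- The Shestakov-Umirbaev primitive operations `p(x₁, …, xₘ; y₁, …, yₙ; z)` of a non-associative
algebra `A` with product `mul` and unit `one`: the non-associative polynomial
`p(u, v, z)`, where `u = ((X₁ X₂) ⋯) Xₘ` and `v = ((Y₁ Y₂) ⋯) Yₙ`, of the free algebra on the variables
`X₁, …, Xₘ, Y₁, …, Yₙ, Z` is evaluated in `A`. -/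
def primOp (mul : A →ₗ[k] A →ₗ[k] A) (one : A) {m n : ℕ} (x : Fin m → A) (y : Fin n → A)
    (z : A) : A :=
  FreeAlg.eval mul one (Sum.elim x (Sum.elim y fun _ : Unit => z))
    (FreeAlg.pOp (FreeAlg.leftNormed k fun i => Sum.inl i)
      (FreeAlg.leftNormed k fun j => Sum.inr (Sum.inl j))
      (FreeAlg.gen k (Sum.inr (Sum.inr ()))))

/-- The Shestakov-Umirbaev brackets of a non-associative algebra `A` with product `mul` and unit
`one`: `⟨1; y, z⟩ = -[y, z] = -yz + zy` and
`⟨x₁, …, xₘ; y, z⟩ = -p(x₁, …, xₘ; y; z) + p(x₁, …, xₘ; z; y)` for `m ≥ 1`. -/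
def suBracket (mul : A →ₗ[k] A →ₗ[k] A) (one : A) : {m : ℕ} → (Fin m → A) → A → A → A
  | 0, _, y, z => -mul y z + mul z y
  | _ + 1, x, y, z => -primOp mul one x ![y] z + primOp mul one x ![z] y

end PrimitiveOperations

end SabininTheory

end

/-! Write `R_v` for right multiplication by `v ∈ V` in `k[F]`. Since `F'` is an exponential, `R_v(μ)
= ∑ μ₍₁₎ (μ₍₂₎ * v)`, so `R_v` is the derivation along the adapted field `v^*`
(`FormalLoop.shift_adapted`). It is also a coderivation, because the product is a coalgebra map and
`v` is primitive.

Every formal vector field is uniquely `B(μ) = ∑ μ₍₁₎ * b(μ₍₂₎)`; call `b` its coordinate in the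
adapted frame. By the Leibniz rule for `R_v`, the operator `∇_{v^*}` acts on coordinates as `b ↦ b ∘
R_v` (`FormalLoop.nabla_adapted`). If `t` is the coordinate of `T(y^*, z^*)`, this gives `⟨x₁, …,
xₙ; y, z⟩_F = t(w)` with `w = ((x₁ x₂) ⋯) xₙ`. Adapted fields have constant coordinates and are
parallel, so `T(y^*, z^*) = -[y^*, z^*]`, whose derivation is `R_y R_z - R_z R_y`
(`FormalLoop.shift_torsion`).

On the algebraic side `p(x; y; z) = Q_{y,z}(w)`, where `∑ μ₍₁₎ · Q_{y,z}(μ₍₂₎) = (μ, y, z)`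
(`FormalLoop.primOp_eq`). Now `(μ, z, y) - (μ, y, z) = (R_y R_z - R_z R_y)(μ) + μ · (yz - zy)`, and
the commutator equals `∑ μ₍₁₎ · t(μ₍₂₎)`. Left division yields `Q_{z,y} - Q_{y,z} = t + ε (yz - zy)`
(`FormalLoop.associatorQuotient_sub`). Evaluate at `w`: for `n ≥ 1` the counit of `w` vanishes, and
for `n = 0` both quotients vanish at `w = 1`. -/

noncomputable section

namespace SabininTheory

/-! ### Action of the convolution algebra on vector-valued maps -/

section Action

variable {k C N : Type*} [Field k] [AddCommGroup C] [Module k C] [Coalgebra k C]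
  [AddCommGroup N] [Module k N]

/-- The action `c ↦ ∑ f(c₍₁₎)(A(c₍₂₎))` of the convolution algebra of maps `C → End(N)` on the space
of maps `C → N`. -/
def convSMul (f : C →ₗ[k] Module.End k N) (A : C →ₗ[k] N) : C →ₗ[k] N :=
  TensorProduct.lift f ∘ₗ LinearMap.lTensor C A ∘ₗ comul

theorem convSMul_apply (f : C →ₗ[k] Module.End k N) (A : C →ₗ[k] N) (c : C) :
    convSMul f A c = ∑ i ∈ (ℛ k c).index, f ((ℛ k c).left i) (A ((ℛ k c).right i)) := by
  simp only [convSMul, LinearMap.comp_apply]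
  nth_rw 1 [← (ℛ k c).eq]
  simp

theorem convSMul_sub_right (f : C →ₗ[k] Module.End k N) (A B : C →ₗ[k] N) :
    convSMul f (A - B) = convSMul f A - convSMul f B := by
  ext c
  simp [convSMul_apply]

theorem convSMul_add_right (f : C →ₗ[k] Module.End k N) (A B : C →ₗ[k] N) :
    convSMul f (A + B) = convSMul f A + convSMul f B := by
  ext c
  simp [convSMul_apply, Finset.sum_add_distrib]

/-- Coassociativity. This makes left division a matter of inverting `f` in the convolution algebra.
-/
theorem convSMul_convSMul (f g : C →ₗ[k] Module.End k N) (A : C →ₗ[k] N) :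
    convSMul f (convSMul g A) = convSMul (toConv f * toConv g).ofConv A := by
  ext c
  have h1 : convSMul f (convSMul g A) c =
      (TensorProduct.lift f ∘ₗ LinearMap.lTensor C (TensorProduct.lift g ∘ₗ LinearMap.lTensor C A))
        (LinearMap.lTensor C comul (comul (R := k) c)) := by
    simp only [convSMul, LinearMap.comp_apply, ← LinearMap.lTensor_comp_apply,
      LinearMap.comp_assoc]
  have h2 : convSMul (toConv f * toConv g).ofConv A c =
      (TensorProduct.lift (LinearMap.mul' k (Module.End k N) ∘ₗ TensorProduct.map f g) ∘ₗ
        LinearMap.lTensor (C ⊗[k] C) A) (LinearMap.rTensor C comul (comul (R := k) c)) := by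
    simp only [convSMul, LinearMap.comp_apply, LinearMap.convMul_def]
    induction comul (R := k) c using TensorProduct.induction_on with
    | zero => simp
    | tmul a b => simp
    | add x y hx hy => rw [map_add, map_add, hx, hy, map_add, map_add, map_add]
  rw [h1, h2, ← coassoc_apply]
  induction LinearMap.rTensor C comul (comul (R := k) c) using TensorProduct.induction_on with
  | zero => simp
  | add x y hx hy => rw [map_add, map_add, hx, hy, map_add]
  | tmul p b =>
    induction p using TensorProduct.induction_on with
    | zero => simp
    | add x y hx hy => simp only [TensorProduct.add_tmul, map_add, hx, hy]
    | tmul a a' => simp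

theorem convSMul_one (A : C →ₗ[k] N) :
    convSMul (1 : WithConv (C →ₗ[k] Module.End k N)).ofConv A = A := by
  ext c
  rw [convSMul_apply]
  have : ∀ a, (1 : WithConv (C →ₗ[k] Module.End k N)).ofConv a =
      algebraMap k (Module.End k N) (counit a) := fun a => rfl
  simp only [this, Module.algebraMap_end_apply, ← map_smul, ← map_sum]
  rw [sum_counit_smul]

theorem convSMul_cancel {f : C →ₗ[k] Module.End k N} (hf : IsUnit (toConv f)) {A B : C →ₗ[k] N}
    (h : convSMul f A = convSMul f B) : A = B := by
  have := congrArg (convSMul (Ring.inverse (toConv f)).ofConv) h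
  simpa only [convSMul_convSMul, toConv_ofConv, Ring.inverse_mul_cancel _ hf, convSMul_one]
    using this

theorem convSMul_inverse {f : C →ₗ[k] Module.End k N} (hf : IsUnit (toConv f)) (A : C →ₗ[k] N) :
    convSMul f (convSMul (Ring.inverse (toConv f)).ofConv A) = A := by
  simp only [convSMul_convSMul, toConv_ofConv, Ring.mul_inverse_cancel _ hf, convSMul_one]

theorem convSMul_coalgHom {D : Type*} [AddCommGroup D] [Module k D] [Coalgebra k D]
    {φ : D →ₗ[k] C} (hφ : ∀ d, comul (R := k) (φ d) = TensorProduct.map φ φ (comul (R := k) d))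
    (f : C →ₗ[k] Module.End k N) (A : C →ₗ[k] N) :
    convSMul f A ∘ₗ φ = convSMul (f ∘ₗ φ) (A ∘ₗ φ) := by
  ext d
  simp only [convSMul, LinearMap.comp_apply, hφ]
  induction comul (R := k) d using TensorProduct.induction_on with
  | zero => simp
  | tmul a b => simp
  | add x y hx hy => simp only [map_add, hx, hy]

end Action

/-! ### Leibniz rules for coderivations -/

section Coderivation

variable {k C N : Type*} [Field k] [AddCommGroup C] [Module k C] [Coalgebra k C]
  [AddCommGroup N] [Module k N]

/-- Coderivations of a coalgebra. -/
def IsCoderivation (D : C →ₗ[k] C) : Prop :=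
  ∀ c, comul (R := k) (D c) = D.rTensor C (comul (R := k) c) + D.lTensor C (comul (R := k) c)

theorem IsCoderivation.convSMul_comp {D : C →ₗ[k] C} (hD : IsCoderivation D)
    (f : C →ₗ[k] Module.End k N) (A : C →ₗ[k] N) :
    convSMul f A ∘ₗ D = convSMul (f ∘ₗ D) A + convSMul f (A ∘ₗ D) := by
  ext c
  simp only [convSMul, LinearMap.comp_apply, hD c, LinearMap.add_apply, map_add]
  congr 1
  · induction comul (R := k) c using TensorProduct.induction_on with
    | zero => simp
    | tmul a b => simp
    | add x y hx hy => simp only [map_add, hx, hy]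
  · rw [LinearMap.lTensor_comp_apply]

theorem IsCoderivation.convMul_comp {R : Type*} [Ring R] [Algebra k R] {D : C →ₗ[k] C}
    (hD : IsCoderivation D) (f g : WithConv (C →ₗ[k] R)) :
    toConv ((f * g).ofConv ∘ₗ D) = toConv (f.ofConv ∘ₗ D) * g + f * toConv (g.ofConv ∘ₗ D) := by
  refine WithConv.ext (LinearMap.ext fun c => ?_)
  simp only [LinearMap.convMul_def, LinearMap.comp_apply, hD c, ofConv_add, LinearMap.add_apply,
    map_add, ofConv_toConv]
  congr 1
  · induction comul (R := k) c using TensorProduct.induction_on with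
    | zero => simp
    | tmul a b => simp
    | add x y hx hy => simp only [map_add, hx, hy]
  · induction comul (R := k) c using TensorProduct.induction_on with
    | zero => simp
    | tmul a b => simp
    | add x y hx hy => simp only [map_add, hx, hy]

end Coderivation

/-! ### Exponentials in the convolution algebra and their differential equation -/

section Exponential

variable {k V W R : Type*} [Field k] [AddCommGroup V] [Module k V] [AddCommGroup W] [Module k W]
  [CommRing R] [Algebra k R]

theorem convDer_apply (v : V) (f : WithConv (SymmetricAlgebra k V →ₗ[k] R))
    (c : SymmetricAlgebra k V) :
    (convDer v f).ofConv c = f.ofConv (SymmetricAlgebra.ι k V v * c) := rfl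

/-- The derivative along `v` records the values on the multiples of `v`, and these together with `1`
span `k[V]`; no division by integers is involved. -/
theorem eq_zero_of_convDer_eq_zero {f : WithConv (SymmetricAlgebra k V →ₗ[k] R)}
    (h1 : f.ofConv 1 = 0) (h : ∀ v, convDer v f = 0) : f = 0 := by
  have H : ∀ c : SymmetricAlgebra k V, ∀ b, f.ofConv b = 0 → f.ofConv (c * b) = 0 := by
    intro c
    induction c using SymmetricAlgebra.induction with
    | algebraMap r => intro b hb; rw [← Algebra.smul_def, map_smul, hb, smul_zero]
    | ι v => intro b _; rw [← convDer_apply, h v]; rfl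
    | mul a b ha hb => intro c hc; rw [mul_assoc]; exact ha _ (hb _ hc)
    | add a b ha hb => intro c hc; rw [add_mul, map_add, ha c hc, hb c hc, add_zero]
  refine WithConv.ext (LinearMap.ext fun c => ?_)
  have := H c 1 h1
  rwa [mul_one] at this

theorem isUnit_of_apply_one {A : Type*} [Ring A] [Algebra k A]
    (f : WithConv (SymmetricAlgebra k V →ₗ[k] A)) (h : f.ofConv 1 = 1) : IsUnit f :=
  isUnit_of_locNilp _ fun c => conv_pow_locNilp _ (by simp [h]) c

/-- Uniqueness for the first order linear system `∂_v X = g_v X`. -/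
theorem eq_of_convDer_eq {X Y : WithConv (SymmetricAlgebra k V →ₗ[k] R)}
    (g : V → WithConv (SymmetricAlgebra k V →ₗ[k] R)) (hX1 : X.ofConv 1 = 1) (hY1 : Y.ofConv 1 = 1)
    (hX : ∀ v, convDer v X = g v * X) (hY : ∀ v, convDer v Y = g v * Y) : X = Y := by
  obtain ⟨u, rfl⟩ := isUnit_of_apply_one Y hY1
  -- Quotient of two solutions: its derivatives vanish, so it is the constant `1`.
  obtain ⟨Q, hQ⟩ : ∃ Q, X = Q * u := ⟨X * ↑u⁻¹, by simp⟩
  have hQ1 : Q.ofConv 1 = 1 := by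
    rw [hQ, conv_apply_one, hY1, mul_one] at hX1
    exact hX1
  have hQ' : Q - 1 = 0 := by
    refine eq_zero_of_convDer_eq_zero (by simp [hQ1]) fun v => ?_
    have e := hX v
    rw [hQ, convDer_mul, hY v] at e
    have e2 : convDer v Q * (u : WithConv (SymmetricAlgebra k V →ₗ[k] R)) = 0 := by
      linear_combination e
    have e3 : convDer v Q = 0 := by
      simpa using e2
    have e4 : convDer v (1 : WithConv (SymmetricAlgebra k V →ₗ[k] R)) = 0 := by
      refine WithConv.ext (LinearMap.ext fun c => ?_)
      rw [convDer_apply]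
      simp
    have e5 : convDer v (Q - 1) = convDer v Q - convDer v 1 := by
      simp [convDer, LinearMap.sub_comp]
    rw [e5, e3, e4, sub_zero]
  rw [hQ, sub_eq_zero.mp hQ', one_mul]

theorem convDer_pow (v : V) (f : WithConv (SymmetricAlgebra k V →ₗ[k] R)) (n : ℕ) :
    convDer v (f ^ (n + 1)) = ((n : k) + 1) • (convDer v f * f ^ n) := by
  induction n with
  | zero => simp
  | succ n ih =>
    rw [pow_succ, convDer_mul, ih]
    simp only [Algebra.smul_def, map_add, map_one, map_natCast, Nat.cast_add, Nat.cast_one]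
    ring

theorem FormalMap.induced_eq_sum (θ : FormalMap k V W) (s : Finset (SymmetricAlgebra k V)) :
    ∃ N₀, ∀ N, N₀ ≤ N → ∀ c ∈ s, θ.induced c = ∑ n ∈ Finset.range N, (n.factorial : k)⁻¹ •
      (toConv (SymmetricAlgebra.ι k W ∘ₗ θ.toLin) ^ n).ofConv c := by
  choose N hN using θ.ι_comp_locNilp
  refine ⟨s.sup N, fun M hM c hc => ?_⟩
  exact locSum_apply _ _ c M fun n hn => hN c n ((Finset.le_sup hc).trans (hM.trans hn))

theorem FormalMap.induced_one (θ : FormalMap k V W) : θ.induced 1 = 1 := by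
  have := locSum_apply (R := SymmetricAlgebra k W) _ θ.ι_comp_locNilp 1 1 fun n hn => by
    obtain ⟨n, rfl⟩ := Nat.exists_eq_add_of_le' hn
    rw [LinearMap.smul_apply, pow_succ, conv_apply_one]
    simp [θ.map_one]
  refine this.trans ?_
  simp

/-- The chain rule `∂_v exp θ = (∂_v θ) exp θ`. Characteristic zero enters through `(n + 1) / (n +
1)! = 1 / n!`. -/
theorem FormalMap.convDer_induced [CharZero k] (θ : FormalMap k V W) (v : V) :
    convDer v (toConv θ.induced) =
      convDer v (toConv (SymmetricAlgebra.ι k W ∘ₗ θ.toLin)) * toConv θ.induced := by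
  classical
  refine WithConv.ext (LinearMap.ext fun c => ?_)
  set f := toConv (SymmetricAlgebra.ι k W ∘ₗ θ.toLin) with hf
  obtain ⟨N₁, h₁⟩ := θ.induced_eq_sum {SymmetricAlgebra.ι k V v * c}
  obtain ⟨N₂, h₂⟩ := θ.induced_eq_sum ((ℛ k c).index.image (ℛ k c).right)
  -- The series is finite only pointwise, so one truncation must serve every element in sight. The
  -- left side gets one more term because differentiation lowers the exponent by one.
  have e₁ := h₁ (max N₁ N₂ + 1) (by omega) _ (Finset.mem_singleton_self _)
  have e₂ := h₂ (max N₁ N₂) (le_max_right _ _)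
  rw [convDer_apply, ofConv_toConv, e₁, (ℛ k c).convMul_apply, Finset.sum_range_succ']
  have z : ((Nat.factorial 0 : k)⁻¹ • (f ^ 0).ofConv (SymmetricAlgebra.ι k V v * c)) = 0 := by
    simp
  rw [z, add_zero]
  have s : ∀ n, ((n + 1).factorial : k)⁻¹ • (f ^ (n + 1)).ofConv (SymmetricAlgebra.ι k V v * c) =
      (n.factorial : k)⁻¹ • (convDer v f * f ^ n).ofConv c := by
    intro n
    rw [← convDer_apply, convDer_pow, ofConv_smul, LinearMap.smul_apply, smul_smul,
      Nat.factorial_succ]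
    congr 1
    have : (n : k) + 1 ≠ 0 := by exact_mod_cast n.succ_ne_zero
    have h' : (n.factorial : k) ≠ 0 := by exact_mod_cast n.factorial_ne_zero
    push_cast
    field_simp
  rw [Finset.sum_congr rfl fun n _ => s n]
  have e : ∀ i ∈ (ℛ k c).index, (convDer v f).ofConv ((ℛ k c).left i) *
      θ.induced ((ℛ k c).right i) = ∑ n ∈ Finset.range (max N₁ N₂), (n.factorial : k)⁻¹ •
        ((convDer v f).ofConv ((ℛ k c).left i) * (f ^ n).ofConv ((ℛ k c).right i)) := by
    intro i hi
    rw [e₂ _ (Finset.mem_image_of_mem _ hi), Finset.mul_sum]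
    exact Finset.sum_congr rfl fun n _ => mul_smul_comm _ _ _
  refine Eq.trans ?_ (Finset.sum_congr rfl e).symm
  rw [Finset.sum_comm]
  refine Finset.sum_congr rfl fun n _ => ?_
  rw [← Finset.smul_sum]
  congr 1
  exact (ℛ k c).convMul_apply _ _

end Exponential

/-! ### Functoriality of the symmetric algebra -/

section SymMap

variable {k V W : Type*} [Field k] [AddCommGroup V] [Module k V] [AddCommGroup W] [Module k W]

theorem symMap_ι (f : V →ₗ[k] W) (v : V) :
    symMap f (SymmetricAlgebra.ι k V v) = SymmetricAlgebra.ι k W (f v) := by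
  simp [symMap]

theorem symMap_id (μ : SymmetricAlgebra k V) : symMap (LinearMap.id : V →ₗ[k] V) μ = μ := by
  have : symMap (LinearMap.id : V →ₗ[k] V) = AlgHom.id k _ := by
    ext v
    simp [symMap]
  rw [this, AlgHom.id_apply]

theorem shift_eq_conv (A : SymmetricAlgebra k V →ₗ[k] V) : toConv (shift A) =
    toConv LinearMap.id * toConv (SymmetricAlgebra.ι k V ∘ₗ A) := rfl

theorem comul_symMap (f : V →ₗ[k] W) (μ : SymmetricAlgebra k V) :
    comul (R := k) (symMap f μ) = TensorProduct.map (symMap f).toLinearMap (symMap f).toLinearMap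
      (comul (R := k) μ) := by
  have : (Bialgebra.comulAlgHom k (SymmetricAlgebra k W)).comp (symMap f) =
      (Algebra.TensorProduct.map (symMap f) (symMap f)).comp
        (Bialgebra.comulAlgHom k (SymmetricAlgebra k V)) := by
    ext v
    simp [symMap]
  exact DFunLike.congr_fun this μ

end SymMap

/-! ### Induced maps are coalgebra morphisms -/

section ExponentialHom

variable {k V W R : Type*} [Field k] [CharZero k] [AddCommGroup V] [Module k V] [AddCommGroup W]
  [Module k W] [CommRing R] [Algebra k R]

theorem FormalMap.convDer_algHom_induced (θ : FormalMap k V W) (h : SymmetricAlgebra k W →ₐ[k] R)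
    (v : V) : convDer v (toConv (h.toLinearMap ∘ₗ θ.induced)) =
      toConv (h.toLinearMap ∘ₗ
        (convDer v (toConv (SymmetricAlgebra.ι k W ∘ₗ θ.toLin))).ofConv) *
        toConv (h.toLinearMap ∘ₗ θ.induced) := by
  have e : convDer v (toConv (h.toLinearMap ∘ₗ θ.induced)) =
      toConv (h.toLinearMap ∘ₗ (convDer v (toConv θ.induced)).ofConv) := rfl
  rw [e, θ.convDer_induced, LinearMap.algHom_comp_convMul_distrib]

/-- Both sides are `1` at `1` and solve the same linear system. On the right stands the product of
the exponentials `θ' ⊗ 1` and `1 ⊗ θ'`; their logarithmic derivatives add up to `Δ ∘ ∂_v θ` because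
`θ` takes primitive values. -/
theorem FormalMap.comul_induced (θ : FormalMap k V W) (c : SymmetricAlgebra k V) :
    comul (R := k) (θ.induced c) =
      TensorProduct.map θ.induced θ.induced (comul (R := k) c) := by
  set hC := Bialgebra.comulAlgHom k (SymmetricAlgebra k W)
  set hL : SymmetricAlgebra k W →ₐ[k] _ :=
    Algebra.TensorProduct.includeLeft (R := k) (S := k) (A := SymmetricAlgebra k W)
      (B := SymmetricAlgebra k W) with hhL
  set hR : SymmetricAlgebra k W →ₐ[k] _ :=
    Algebra.TensorProduct.includeRight (R := k) (A := SymmetricAlgebra k W)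
      (B := SymmetricAlgebra k W) with hhR
  set g : V → WithConv (SymmetricAlgebra k V →ₗ[k] SymmetricAlgebra k W) :=
    fun v => convDer v (toConv (SymmetricAlgebra.ι k W ∘ₗ θ.toLin)) with hg
  have hY : toConv (TensorProduct.map θ.induced θ.induced ∘ₗ comul (R := k)) =
      toConv (hL.toLinearMap ∘ₗ θ.induced) * toConv (hR.toLinearMap ∘ₗ θ.induced) := by
    refine WithConv.ext (LinearMap.ext fun d => ?_)
    simp only [LinearMap.convMul_def, LinearMap.comp_apply, ofConv_toConv]
    induction comul (R := k) d using TensorProduct.induction_on with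
    | zero => simp
    | tmul a b => simp [hhL, hhR]
    | add x y hx hy => simp only [map_add, hx, hy]
  have key : toConv (comul (R := k) ∘ₗ θ.induced) =
      toConv (TensorProduct.map θ.induced θ.induced ∘ₗ comul (R := k)) := by
    refine eq_of_convDer_eq (fun v => toConv (hC.toLinearMap ∘ₗ (g v).ofConv)) ?_ ?_
      (fun v => θ.convDer_algHom_induced hC v) fun v => ?_
    · simp [θ.induced_one, Algebra.TensorProduct.one_def]
    · simp [θ.induced_one, Algebra.TensorProduct.one_def]
    · have hsum : toConv (hC.toLinearMap ∘ₗ (g v).ofConv) =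
          toConv (hL.toLinearMap ∘ₗ (g v).ofConv) + toConv (hR.toLinearMap ∘ₗ (g v).ofConv) := by
        refine WithConv.ext (LinearMap.ext fun d => ?_)
        change comul (R := k) (SymmetricAlgebra.ι k W (θ.toLin _)) = _
        rw [SymmetricAlgebra.comul_ι]
        rfl
      rw [hY, convDer_mul, θ.convDer_algHom_induced, θ.convDer_algHom_induced, hsum]
      ring
  exact LinearMap.congr_fun (congrArg WithConv.ofConv key) c

/-- The map induced by a formal map that restricts to a linear map `g` along `f` restricts to the
algebra map induced by `g`. -/
theorem FormalMap.induced_symMap {U : Type*} [AddCommGroup U] [Module k U] (θ : FormalMap k V W)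
    (f : U →ₗ[k] V) (g : U →ₗ[k] W) (h : ∀ μ, θ.toLin (symMap f μ) = g (proj k U μ))
    (μ : SymmetricAlgebra k U) : θ.induced (symMap f μ) = symMap g μ := by
  have key : toConv (θ.induced ∘ₗ (symMap f).toLinearMap) =
      toConv (symMap g).toLinearMap := by
    refine eq_of_convDer_eq (fun v => convDer v
      (toConv (SymmetricAlgebra.ι k W ∘ₗ g ∘ₗ proj k U))) ?_ ?_ (fun v => ?_) fun v => ?_
    · simp [θ.induced_one]
    · simp
    · refine WithConv.ext (LinearMap.ext fun d => ?_)
      have e : (convDer v (toConv (θ.induced ∘ₗ (symMap f).toLinearMap))).ofConv d =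
          (convDer (f v) (toConv θ.induced)).ofConv (symMap f d) := by
        simp [convDer_apply, symMap_ι]
      have e' : ∀ a, (convDer (f v) (toConv (SymmetricAlgebra.ι k W ∘ₗ θ.toLin))).ofConv
          (symMap f a) = SymmetricAlgebra.ι k W (g (proj k U (SymmetricAlgebra.ι k U v * a))) := by
        intro a
        rw [← h, map_mul, symMap_ι]
        rfl
      rw [e, θ.convDer_induced]
      simp only [LinearMap.convMul_def, LinearMap.comp_apply, comul_symMap]
      induction comul (R := k) d using TensorProduct.induction_on with
      | zero => simp
      | tmul a b => simp [e', convDer_apply]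
      | add x y hx hy => simp only [map_add, hx, hy]
    -- The derivative of `g ∘ π_V` along `v` is the constant `ε · g(v)`, so the equation says that
    -- an algebra map sends `v d` to `g(v)` times the image of `d`.
    · refine WithConv.ext (LinearMap.ext fun d => ?_)
      have e : ∀ a, (convDer v (toConv (SymmetricAlgebra.ι k W ∘ₗ g ∘ₗ proj k U))).ofConv a =
          counit (R := k) a • SymmetricAlgebra.ι k W (g v) := by
        intro a
        rw [convDer_apply]
        simp [proj_mul, proj_ι]
      rw [(ℛ k d).convMul_apply, convDer_apply]
      simp only [e, AlgHom.toLinearMap_apply, map_mul, symMap_ι]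
      nth_rw 1 [← sum_counit_smul (ℛ k d)]
      simp [Finset.mul_sum]
  exact LinearMap.congr_fun (congrArg WithConv.ofConv key) μ

end ExponentialHom

/-! ### Primitive elements of the symmetric algebra -/

section Primitive

variable {k V : Type*} [Field k] [CharZero k] [AddCommGroup V] [Module k V]

/-- The exponential of the projection to degree one is the identity. -/
theorem induced_proj (μ : SymmetricAlgebra k V) :
    (⟨proj k V, proj_one⟩ : FormalMap k V V).induced μ = μ := by
  have := (⟨proj k V, proj_one⟩ : FormalMap k V V).induced_symMap LinearMap.id LinearMap.id
    (fun μ => by rw [symMap_id]; rfl) μ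
  rwa [symMap_id] at this

/-- The identity is the exponential of `π_V`. On a primitive element its constant term vanishes with
the counit, and convolution powers of exponent at least two vanish because `π_V(1) = 0`; only the
linear term survives. -/
theorem IsPrim.eq_ι_proj {μ : SymmetricAlgebra k V} (h : IsPrim μ) :
    μ = SymmetricAlgebra.ι k V (proj k V μ) := by
  set f := toConv (SymmetricAlgebra.ι k V ∘ₗ proj k V) with hf
  have hf1 : f.ofConv 1 = 0 := by simp [hf, proj_one]
  have hc : counit (R := k) μ = 0 := by
    have := rTensor_counit_comul (R := k) μ
    rw [h, map_add, LinearMap.rTensor_tmul, LinearMap.rTensor_tmul, Bialgebra.counit_one] at this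
    have h2 := congrArg (TensorProduct.lid k _) this
    simp only [map_add, TensorProduct.lid_tmul, one_smul, add_eq_right] at h2
    have h3 := congrArg (counit (R := k)) h2
    simpa using h3
  have hmul : ∀ a b : WithConv (SymmetricAlgebra k V →ₗ[k] SymmetricAlgebra k V),
      (a * b).ofConv μ = a.ofConv μ * b.ofConv 1 + a.ofConv 1 * b.ofConv μ := by
    intro a b
    have hμ : comul (R := k) μ = μ ⊗ₜ[k] 1 + 1 ⊗ₜ[k] μ := h
    simp [LinearMap.convMul_def, hμ]
  have hn : ∀ n, (f ^ (n + 2)).ofConv μ = 0 := by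
    intro n
    rw [pow_succ', hmul, hf1, zero_mul, add_zero, pow_succ, conv_apply_one, hf1, mul_zero, mul_zero]
  have e := locSum_apply (R := SymmetricAlgebra k V) _
    (⟨proj k V, proj_one⟩ : FormalMap k V V).ι_comp_locNilp μ 2 fun n hn' => by
      obtain ⟨n, rfl⟩ := Nat.exists_eq_add_of_le' hn'
      rw [LinearMap.smul_apply, hn, smul_zero]
  refine (induced_proj μ).symm.trans (e.trans ?_)
  simp [Finset.sum_range_succ, hc]

end Primitive

/-! ### The bialgebra of a formal loop -/

section FormalLoop

variable {k V : Type*} [Field k] [CharZero k] [AddCommGroup V] [Module k V] (F : FormalLoop k V)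

/-- On `k[V] ⊗ 1` the formal loop is `π_V`, whose exponential is the identity. -/
theorem FormalLoop.prod_one (μ : SymmetricAlgebra k V) : F.prod μ 1 = μ := by
  have := F.induced_symMap (LinearMap.inl k V V) LinearMap.id (fun ν => by
    rw [LinearMap.id_apply, ← F.mul_unit]
    simp [tensorToProd]) μ
  rw [symMap_id] at this
  simpa [FormalLoop.prod, tensorToProd] using this

theorem FormalLoop.one_prod (μ : SymmetricAlgebra k V) : F.prod 1 μ = μ := by
  have := F.induced_symMap (LinearMap.inr k V V) LinearMap.id (fun ν => by
    rw [LinearMap.id_apply, ← F.unit_mul]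
    simp [tensorToProd]) μ
  rw [symMap_id] at this
  simpa [FormalLoop.prod, tensorToProd] using this

theorem FormalLoop.comul_prod (μ ν : SymmetricAlgebra k V) :
    comul (R := k) (F.prod μ ν) =
      TensorProduct.map₂ F.prod F.prod (comul (R := k) μ) (comul (R := k) ν) := by
  simp only [FormalLoop.prod, tensorToProd, LinearMap.compr₂_apply, LinearMap.compl₁₂_apply,
    AlgHom.toLinearMap_apply, LinearMap.mul_apply', FormalMap.comul_induced, Bialgebra.comul_mul,
    comul_symMap]
  induction comul (R := k) μ using TensorProduct.induction_on with
  | zero => simp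
  | add x y hx hy => simp only [map_add, add_mul, LinearMap.add_apply, hx, hy]
  | tmul a b =>
    induction comul (R := k) ν using TensorProduct.induction_on with
    | zero => simp
    | add x y hx hy => simp only [map_add, mul_add, hx, hy]
    | tmul c d => simp

theorem FormalLoop.isCoderivation_prod (v : V) :
    IsCoderivation (F.prod.flip (SymmetricAlgebra.ι k V v)) := by
  intro c
  rw [LinearMap.flip_apply, F.comul_prod, SymmetricAlgebra.comul_ι]
  induction comul (R := k) c using TensorProduct.induction_on with
  | zero => simp
  | add x y hx hy => simp only [map_add, LinearMap.add_apply] at hx hy ⊢; linear_combination (norm := module) hx + hy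
  | tmul a b => simp [F.prod_one]

/-- Right multiplication by a vector `v` in `k[F]` is the coderivation given by the vector field
adapted to `v`. -/
theorem FormalLoop.shift_adapted (v : V) :
    shift (F.connection.adapted v) = F.prod.flip (SymmetricAlgebra.ι k V v) := by
  ext c
  -- `c · v` is the derivative of `F'` in the direction `(0, v)` at `c ⊗ 1`. The exponential
  -- equation turns it into `∑ (c₍₁₎ * v) F'(c₍₂₎ ⊗ 1) = ∑ (c₍₁₎ * v) c₍₂₎`.
  have e : F.prod c (SymmetricAlgebra.ι k V v) =
      (convDer ((0, v) : V × V) (toConv F.induced)).ofConv (symMap (LinearMap.inl k V V) c) := by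
    simp [FormalLoop.prod, tensorToProd, convDer_apply, symMap_ι, mul_comm]
  have e1 : ∀ a, F.induced (symMap (LinearMap.inl k V V) a) = a := fun a => by
    have := F.prod_one a
    simpa [FormalLoop.prod, tensorToProd] using this
  have e2 : ∀ a, (convDer ((0, v) : V × V)
      (toConv (SymmetricAlgebra.ι k V ∘ₗ F.toLin))).ofConv (symMap (LinearMap.inl k V V) a) =
        SymmetricAlgebra.ι k V (F.connection.adapted v a) := fun a => by
    simp [FlatConnection.adapted, FormalLoop.connection, tensorToProd, convDer_apply, symMap_ι,
      mul_comm]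
  rw [LinearMap.flip_apply, e, F.convDer_induced]
  have hcomm : shift (F.connection.adapted v) =
      (toConv (SymmetricAlgebra.ι k V ∘ₗ F.connection.adapted v) * toConv LinearMap.id).ofConv := by
    rw [mul_comm, ← shift_eq_conv]
  rw [hcomm]
  simp only [LinearMap.convMul_def, LinearMap.comp_apply, comul_symMap]
  induction comul (R := k) c using TensorProduct.induction_on with
  | zero => simp
  | tmul a b => simp [e2, e1]
  | add x y hx hy => simp only [map_add, hx, hy]

end FormalLoop

/-! ### Constant coordinates and associators -/

section Counit

variable {k C N : Type*} [Field k] [AddCommGroup C] [Module k C] [Coalgebra k C]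
  [AddCommGroup N] [Module k N]

theorem convSMul_counit_smulRight (f : C →ₗ[k] Module.End k N) (x : N) :
    convSMul f ((counit (R := k) (A := C)).smulRight x) = f.flip x := by
  ext c
  have h := congrArg (TensorProduct.lift f ∘ₗ LinearMap.lTensor C (LinearMap.toSpanSingleton k N x))
    (lTensor_counit_comul (R := k) c)
  have e : (counit (R := k) (A := C)).smulRight x = LinearMap.toSpanSingleton k N x ∘ₗ counit := by
    ext
    simp
  rw [LinearMap.comp_apply, ← LinearMap.lTensor_comp_apply, ← e] at h
  refine h.trans ?_
  simp

/-- Each summand has a factor in `V`. Used twice: constant coordinates are killed by derivations,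
and a nonempty left-normed product of vectors has counit zero. -/
theorem counit_shift {V : Type*} [AddCommGroup V] [Module k V]
    (A : SymmetricAlgebra k V →ₗ[k] V) (μ : SymmetricAlgebra k V) :
    counit (R := k) (shift A μ) = 0 := by
  simp only [shift, LinearMap.comp_apply]
  induction comul (R := k) μ using TensorProduct.induction_on with
  | zero => simp
  | tmul a b => simp
  | add x y hx hy => simp only [map_add, hx, hy, add_zero]

/-- The map `a ↦ (a, b, c) = (a b) c - a (b c)`. -/
def rightAssociator (mul : N →ₗ[k] N →ₗ[k] N) (b c : N) : N →ₗ[k] N :=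
  mul.flip c ∘ₗ mul.flip b - mul.flip (mul b c)

end Counit

/-! ### The canonical connection in the adapted frame -/

section CanonicalConnection

variable {k V : Type*} [Field k] [AddCommGroup V] [Module k V] (Γ : FlatConnection k V)

/-- With the next lemma: acting by `Γ.ldiv` extracts the coordinate of a field in the adapted frame,
acting by `Γ.toLin` restores the field. `convAct` unfolds to `convSMul`. -/
theorem FlatConnection.convAct_ldiv_toLin (b : SymmetricAlgebra k V →ₗ[k] V) :
    convAct Γ.ldiv (convAct Γ.toLin b) = b := by
  refine (convSMul_convSMul _ _ _).trans ?_
  rw [Γ.ldiv_mul, convSMul_one]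

theorem FlatConnection.convAct_toLin_ldiv (b : SymmetricAlgebra k V →ₗ[k] V) :
    convAct Γ.toLin (convAct Γ.ldiv b) = b := by
  refine (convSMul_convSMul _ _ _).trans ?_
  rw [Γ.mul_ldiv, convSMul_one]

theorem FlatConnection.convAct_toLin_one (b : SymmetricAlgebra k V →ₗ[k] V) :
    convAct Γ.toLin b 1 = b 1 := by
  simp [convAct, Algebra.TensorProduct.one_def, Γ.map_one]

theorem FlatConnection.adapted_eq_convAct (v : V) : Γ.adapted v =
    convAct Γ.toLin ((counit (R := k) (A := SymmetricAlgebra k V)).smulRight v) :=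
  (convSMul_counit_smulRight _ _).symm

variable [CharZero k] (F : FormalLoop k V)

/-- In the frame of adapted vector fields, `∇_{v^*}` is composition with right multiplication
by `v` in `k[F]`. -/
theorem FormalLoop.nabla_adapted (v : V) (b : SymmetricAlgebra k V →ₗ[k] V) :
    F.connection.nabla (F.connection.adapted v) (convAct F.connection.toLin b) =
      convAct F.connection.toLin (b ∘ₗ F.prod.flip (SymmetricAlgebra.ι k V v)) := by
  rw [FlatConnection.nabla, FlatConnection.convAct_ldiv_toLin, F.shift_adapted]
  -- Of the two Leibniz terms, the one differentiating the frame is exactly what `∇` subtracts.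
  have := (F.isCoderivation_prod v).convSMul_comp F.connection.toLin b
  exact sub_eq_of_eq_add' this

/-- The outermost derivative is the right multiplication applied first to `μ`, so the right fold of
derivatives becomes a left-normed product in the same order. -/
theorem FormalLoop.nabla_foldr (l : List V) (b : SymmetricAlgebra k V →ₗ[k] V)
    (μ : SymmetricAlgebra k V) :
    convAct F.connection.ldiv (l.foldr (fun v A =>
      F.connection.nabla (F.connection.adapted v) A) (convAct F.connection.toLin b)) μ =
      b (l.foldl (fun a v => F.prod a (SymmetricAlgebra.ι k V v)) μ) := by
  induction l generalizing μ with
  | nil => rw [List.foldr_nil, FlatConnection.convAct_ldiv_toLin, List.foldl_nil]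
  | cons v l ih =>
    rw [List.foldr_cons, List.foldl_cons, ← ih]
    nth_rw 1 [← F.connection.convAct_toLin_ldiv (l.foldr _ _)]
    rw [F.nabla_adapted, FlatConnection.convAct_ldiv_toLin]
    rfl

/-- The coordinate of `z^*` is the constant `ε · z`, and `ε` vanishes on the image of `R_y`. -/
theorem FormalLoop.nabla_adapted_adapted (y z : V) :
    F.connection.nabla (F.connection.adapted y) (F.connection.adapted z) = 0 := by
  rw [F.connection.adapted_eq_convAct z, F.nabla_adapted, ← F.shift_adapted]
  have : (counit (R := k) (A := SymmetricAlgebra k V)).smulRight z ∘ₗ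
      shift (F.connection.adapted y) = 0 := by
    ext μ
    simp [counit_shift]
  rw [this]
  simp [convAct]

/-- `R_y` differentiates the convolution product `R_z = id ⋆ z^*`. The first term is symmetric in
`y` and `z`, so it cancels in the commutator. -/
theorem FormalLoop.prod_flip_comp (y z : V) :
    toConv (F.prod.flip (SymmetricAlgebra.ι k V z) ∘ₗ F.prod.flip (SymmetricAlgebra.ι k V y)) =
      toConv LinearMap.id * toConv (SymmetricAlgebra.ι k V ∘ₗ F.connection.adapted y) *
        toConv (SymmetricAlgebra.ι k V ∘ₗ F.connection.adapted z) +
      toConv (shift (F.connection.adapted z ∘ₗ F.prod.flip (SymmetricAlgebra.ι k V y))) := by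
  have := (F.isCoderivation_prod y).convMul_comp (toConv LinearMap.id)
    (toConv (SymmetricAlgebra.ι k V ∘ₗ F.connection.adapted z))
  rw [← shift_eq_conv, F.shift_adapted] at this
  refine this.trans ?_
  rw [← shift_eq_conv, F.shift_adapted]
  rfl

theorem FormalLoop.shift_torsion (y z : V) :
    shift (F.connection.torsion (F.connection.adapted y) (F.connection.adapted z)) =
      F.prod.flip (SymmetricAlgebra.ι k V y) ∘ₗ F.prod.flip (SymmetricAlgebra.ι k V z) -
      F.prod.flip (SymmetricAlgebra.ι k V z) ∘ₗ F.prod.flip (SymmetricAlgebra.ι k V y) := by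
  have hs : ∀ A B : SymmetricAlgebra k V →ₗ[k] V, shift (A - B) = shift A - shift B := by
    intro A B
    simp [shift, LinearMap.comp_sub, LinearMap.sub_comp]
  rw [FlatConnection.torsion, F.nabla_adapted_adapted, F.nabla_adapted_adapted, sub_zero, zero_sub,
    fieldBracket, neg_sub, hs, F.shift_adapted, F.shift_adapted]
  have h1 := F.prod_flip_comp y z
  have h2 := F.prod_flip_comp z y
  apply toConv_injective
  rw [toConv_sub, toConv_sub, h1, h2]
  ring

/-- Insert `a · v = ∑ a₍₁₎ (a₍₂₎ * v)` and use coassociativity. This links the coordinate of a field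
to left division in `k[F]`. -/
theorem FormalLoop.shift_convAct (b : SymmetricAlgebra k V →ₗ[k] V) :
    shift (convAct F.connection.toLin b) = convSMul F.prod (SymmetricAlgebra.ι k V ∘ₗ b) := by
  ext μ
  have h1 : shift (convAct F.connection.toLin b) μ =
      (LinearMap.mul' k (SymmetricAlgebra k V) ∘ₗ LinearMap.lTensor _ (SymmetricAlgebra.ι k V ∘ₗ
        TensorProduct.lift F.connection.toLin ∘ₗ LinearMap.lTensor _ b))
        (LinearMap.lTensor _ comul (comul (R := k) μ)) := by
    simp only [shift, convAct, LinearMap.comp_apply, ← LinearMap.lTensor_comp_apply,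
      LinearMap.comp_assoc]
  have hp : ∀ a v, F.prod a (SymmetricAlgebra.ι k V v) =
      LinearMap.mul' k _ (LinearMap.lTensor _ (SymmetricAlgebra.ι k V ∘ₗ F.connection.adapted v)
        (comul (R := k) a)) := fun a v => by
    rw [← LinearMap.flip_apply F.prod, ← F.shift_adapted]
    rfl
  have h2 : convSMul F.prod (SymmetricAlgebra.ι k V ∘ₗ b) μ =
      (LinearMap.mul' k (SymmetricAlgebra k V) ∘ₗ LinearMap.lTensor _ (SymmetricAlgebra.ι k V ∘ₗ
        TensorProduct.lift F.connection.toLin ∘ₗ LinearMap.lTensor _ b))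
        (TensorProduct.assoc k _ _ _ (LinearMap.rTensor _ comul (comul (R := k) μ))) := by
    simp only [convSMul, LinearMap.comp_apply]
    induction comul (R := k) μ using TensorProduct.induction_on with
    | zero => simp
    | add x y hx hy => simp only [map_add, hx, hy]
    | tmul a c =>
      rw [LinearMap.lTensor_tmul, TensorProduct.lift.tmul, LinearMap.comp_apply, hp,
        LinearMap.rTensor_tmul]
      induction comul (R := k) a using TensorProduct.induction_on with
      | zero => simp
      | add x y hx hy => simp only [TensorProduct.add_tmul, map_add, hx, hy]
      | tmul a a' => simp [FlatConnection.adapted]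
  rw [h1, h2, coassoc_apply]

end CanonicalConnection

/-! ### Left division of associators in the loop bialgebra -/

section LeftDivision

variable {k V : Type*} [Field k] [CharZero k] [AddCommGroup V] [Module k V] (F : FormalLoop k V)

theorem FormalLoop.isUnit_prod : IsUnit (toConv (F.prod :
    SymmetricAlgebra k V →ₗ[k] Module.End k (SymmetricAlgebra k V))) :=
  isUnit_of_apply_one _ (LinearMap.ext F.one_prod)

/-- The operation `μ ↦ ∑ μ₍₁₎ \ (μ₍₂₎, b, c)` of `k[F]`. -/
def FormalLoop.associatorQuotient (b c : SymmetricAlgebra k V) :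
    SymmetricAlgebra k V →ₗ[k] SymmetricAlgebra k V :=
  convSMul (Ring.inverse (toConv (F.prod :
    SymmetricAlgebra k V →ₗ[k] Module.End k (SymmetricAlgebra k V)))).ofConv
    (rightAssociator F.prod b c)

theorem FormalLoop.convSMul_associatorQuotient (b c : SymmetricAlgebra k V) :
    convSMul F.prod (F.associatorQuotient b c) = rightAssociator F.prod b c :=
  convSMul_inverse F.isUnit_prod _

/-- Undo the left division: the claim becomes `(μ, z, y) - (μ, y, z) = (μz)y - (μy)z + μ(yz - zy)`,
where the commutator of right multiplications comes from the torsion. -/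
theorem FormalLoop.associatorQuotient_sub (y z : V) :
    F.associatorQuotient (SymmetricAlgebra.ι k V z) (SymmetricAlgebra.ι k V y) -
      F.associatorQuotient (SymmetricAlgebra.ι k V y) (SymmetricAlgebra.ι k V z) =
    SymmetricAlgebra.ι k V ∘ₗ convAct F.connection.ldiv
      (F.connection.torsion (F.connection.adapted y) (F.connection.adapted z)) +
    (counit (R := k) (A := SymmetricAlgebra k V)).smulRight
      (F.prod (SymmetricAlgebra.ι k V y) (SymmetricAlgebra.ι k V z) -
        F.prod (SymmetricAlgebra.ι k V z) (SymmetricAlgebra.ι k V y)) := by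
  apply convSMul_cancel F.isUnit_prod
  rw [convSMul_sub_right, convSMul_add_right, F.convSMul_associatorQuotient,
    F.convSMul_associatorQuotient, ← F.shift_convAct, FlatConnection.convAct_toLin_ldiv,
    F.shift_torsion, convSMul_counit_smulRight]
  ext μ
  simp only [rightAssociator, LinearMap.sub_apply, LinearMap.add_apply, LinearMap.comp_apply,
    LinearMap.flip_apply, map_sub]
  abel

end LeftDivision

/-! ### Evaluating the primitive operations of the free algebra -/

section Evaluation

namespace FreeAlg

variable {k S A : Type*} [Field k] [AddCommGroup A] [Module k A] {mul : A →ₗ[k] A →ₗ[k] A}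
  {one : A} {a : S → A}

theorem eval_one : eval mul one a 1 = one := extend_mono _ 1

theorem eval_gen (s : S) : eval mul one a (gen k s) = a s := extend_mono _ _

theorem eval_mul (h1 : ∀ x, mul one x = x) (h2 : ∀ x, mul x one = x) (x y : FreeAlg k S) :
    eval mul one a (x * y) = mul (eval mul one a x) (eval mul one a y) := by
  induction x using FreeAlg.induction with
  | ha x x' hx hx' => rw [add_mul, map_add, hx, hx', map_add, map_add, LinearMap.add_apply]
  | hs r x hx => rw [smul_mul_assoc, map_smul, hx, map_smul, map_smul, LinearMap.smul_apply]
  | hm v =>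
    induction y using FreeAlg.induction with
    | ha x x' hx hx' => rw [mul_add, map_add, hx, hx', map_add, map_add]
    | hs r x hx => rw [mul_smul_comm, map_smul, hx, map_smul, map_smul]
    | hm w =>
      rw [← mono_mul]
      induction v using WithOne.recOneCoe with
      | one => rw [one_mul, mono_one, eval_one, h1]
      | coe t =>
        induction w using WithOne.recOneCoe with
        | one => rw [mul_one, mono_one, eval_one, h2]
        | coe u =>
          rw [eval, extend_mono, extend_mono, extend_mono]
          rfl

/-- The generator is primitive; the coproduct term that puts it on the divisor side leaves an
associator `(u₍₂₎, 1, z) = 0`. -/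
theorem pOp_gen (u z : FreeAlg k S) (s : S) : pOp u (gen k s) z =
    convSMul ldiv (rightAssociator (LinearMap.mul k (FreeAlg k S)) (gen k s) z) u := by
  rw [pOp, TensorProduct.comul_tmul, comul_gen]
  simp only [convSMul, LinearMap.comp_apply]
  induction comul (R := k) u using TensorProduct.induction_on with
  | zero => simp
  | add x y hx hy => simp only [TensorProduct.add_tmul, map_add, hx, hy]
  | tmul a b => simp [TensorProduct.tmul_add, assoc, rightAssociator]

variable {V : Type*} [AddCommGroup V] [Module k V] [CharZero k] (F : FormalLoop k V) (v : S → V)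

theorem comul_eval (u : FreeAlg k S) :
    comul (R := k) (eval F.prod 1 (fun s => SymmetricAlgebra.ι k V (v s)) u) =
      TensorProduct.map (eval F.prod 1 fun s => SymmetricAlgebra.ι k V (v s))
        (eval F.prod 1 fun s => SymmetricAlgebra.ι k V (v s)) (comul (R := k) u) := by
  set φ := eval F.prod 1 fun s => SymmetricAlgebra.ι k V (v s) with hφ
  have hmul : ∀ x y, φ (x * y) = F.prod (φ x) (φ y) := eval_mul F.one_prod F.prod_one
  have hone : φ 1 = 1 := eval_one
  induction u using FreeAlg.induction with
  | ha x y hx hy => simp only [map_add, hx, hy]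
  | hs r x hx => simp only [map_smul, hx]
  | hm w =>
    refine monoid_induction (P := fun u => comul (R := k) (φ u) =
      TensorProduct.map φ φ (comul (R := k) u)) ?_ (fun s => ?_) (fun x y hx hy => ?_) w
    · rw [comul_one, TensorProduct.map_tmul, hone, Bialgebra.comul_one,
        Algebra.TensorProduct.one_def]
    · rw [comul_gen, map_add, TensorProduct.map_tmul, TensorProduct.map_tmul, hone, hφ, eval_gen,
        SymmetricAlgebra.comul_ι]
    · rw [hmul, F.comul_prod, hx, hy, comul_mul]
      induction comul (R := k) x using TensorProduct.induction_on with
      | zero => simp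
      | add x y hx hy => simp only [map_add, add_mul, LinearMap.add_apply, hx, hy]
      | tmul a b =>
        induction comul (R := k) y using TensorProduct.induction_on with
        | zero => simp
        | add x y hx hy => simp only [map_add, mul_add, hx, hy]
        | tmul c d => simp [hmul]

/-- Evaluation respects products and coproducts, hence left division: both sides, as maps out of the
free algebra, become the same associator when multiplied back in `k[F]`, and this multiplication is
cancellable. -/
theorem eval_pOp (u : FreeAlg k S) (s t : S) :
    eval F.prod 1 (fun s => SymmetricAlgebra.ι k V (v s)) (pOp u (gen k s) (gen k t)) =
      F.associatorQuotient (SymmetricAlgebra.ι k V (v s)) (SymmetricAlgebra.ι k V (v t))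
        (eval F.prod 1 (fun s => SymmetricAlgebra.ι k V (v s)) u) := by
  set φ := eval F.prod 1 fun s => SymmetricAlgebra.ι k V (v s) with hφ
  have hmul : ∀ x y, φ (x * y) = F.prod (φ x) (φ y) := eval_mul F.one_prod F.prod_one
  have hgen : ∀ s, φ (gen k s) = SymmetricAlgebra.ι k V (v s) := fun s => eval_gen s
  set q := convSMul ldiv (rightAssociator (LinearMap.mul k (FreeAlg k S)) (gen k s) (gen k t))
    with hq
  -- Left multiplication by `φ(1) = 1` is the identity, so the difference from the convolution unit
  -- is locally nilpotent by degree in the free algebra.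
  have hunit : IsUnit (toConv (F.prod ∘ₗ φ :
      FreeAlg k S →ₗ[k] Module.End k (SymmetricAlgebra k V))) := by
    refine isUnit_of_locNilp _ fun c => conv_pow_locNilp _ ?_ c
    refine LinearMap.ext fun b => ?_
    have h1 : (1 : WithConv (FreeAlg k S →ₗ[k] Module.End k (SymmetricAlgebra k V))).ofConv 1 =
        1 := by
      change algebraMap k _ (counit (R := k) (1 : FreeAlg k S)) = 1
      rw [counit_one, map_one]
    rw [ofConv_sub, LinearMap.sub_apply, h1]
    simp [hφ, eval_one, F.one_prod]
  have hcomp : ∀ A : FreeAlg k S →ₗ[k] FreeAlg k S,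
      convSMul (F.prod ∘ₗ φ) (φ ∘ₗ A) = φ ∘ₗ convSMul (LinearMap.mul k (FreeAlg k S)) A := by
    intro A
    ext c
    simp [convSMul_apply, hmul]
  have key : φ ∘ₗ q = F.associatorQuotient (SymmetricAlgebra.ι k V (v s))
      (SymmetricAlgebra.ι k V (v t)) ∘ₗ φ := by
    apply convSMul_cancel hunit
    rw [hcomp, hq, ← convSMul_coalgHom (comul_eval F v), ← hφ, F.convSMul_associatorQuotient]
    have : convSMul (LinearMap.mul k (FreeAlg k S)) (convSMul ldiv (rightAssociator
        (LinearMap.mul k (FreeAlg k S)) (gen k s) (gen k t))) = _ :=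
      convSMul_inverse isUnit_mul _
    rw [this]
    ext c
    simp [rightAssociator, hmul, hgen]
  rw [pOp_gen]
  exact LinearMap.congr_fun key u

end FreeAlg

theorem FormalLoop.primOp_eq {k V : Type*} [Field k] [CharZero k] [AddCommGroup V] [Module k V]
    (F : FormalLoop k V) {m : ℕ} (x : Fin m → V) (y z : V) :
    primOp F.prod 1 (fun i => SymmetricAlgebra.ι k V (x i)) ![SymmetricAlgebra.ι k V y]
      (SymmetricAlgebra.ι k V z) =
    F.associatorQuotient (SymmetricAlgebra.ι k V y) (SymmetricAlgebra.ι k V z)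
      ((List.ofFn x).foldl (fun a v => F.prod a (SymmetricAlgebra.ι k V v)) 1) := by
  set v : Fin m ⊕ (Fin 1 ⊕ Unit) → V := Sum.elim x (Sum.elim ![y] fun _ => z) with hv
  have e : Sum.elim (fun i => SymmetricAlgebra.ι k V (x i)) (Sum.elim ![SymmetricAlgebra.ι k V y]
      fun _ : Unit => SymmetricAlgebra.ι k V z) = fun s => SymmetricAlgebra.ι k V (v s) := by
    ext s
    rcases s with i | i | i
    · rfl
    · fin_cases i; rfl
    · rfl
  set φ := FreeAlg.eval F.prod 1 fun s => SymmetricAlgebra.ι k V (v s) with hφ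
  have hmul : ∀ x y, φ (x * y) = F.prod (φ x) (φ y) := FreeAlg.eval_mul F.one_prod F.prod_one
  have hfold : ∀ (l : List (Fin m ⊕ (Fin 1 ⊕ Unit))) (u : FreeAlg k _),
      φ (l.foldl (fun a t => a * FreeAlg.gen k t) u) =
        (l.map v).foldl (fun a v => F.prod a (SymmetricAlgebra.ι k V v)) (φ u) := by
    intro l
    induction l with
    | nil => intro u; rfl
    | cons t l ih =>
      intro u
      rw [List.foldl_cons, ih, List.map_cons, List.foldl_cons, hmul, hφ, FreeAlg.eval_gen]
  have h1 : FreeAlg.leftNormed k (fun j : Fin 1 => (Sum.inr (Sum.inl j) : Fin m ⊕ (Fin 1 ⊕ Unit))) =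
      FreeAlg.gen k (Sum.inr (Sum.inl 0)) := by
    simp [FreeAlg.leftNormed]
  rw [primOp, e, h1, FreeAlg.eval_pOp, ← hφ, FreeAlg.leftNormed, hfold, List.map_ofFn]
  rw [show φ 1 = 1 from FreeAlg.eval_one]
  rfl

end Evaluation

end SabininTheory

end

/-! ### Equality of the two families of brackets -/

theorem mainTheorem3 {k : Type*} [Field k] [CharZero k] {V : Type*} [AddCommGroup V] [Module k V]
    (F : SabininTheory.FormalLoop k V) {n : ℕ} (x : Fin n → SymmetricAlgebra k V)
    (y z : SymmetricAlgebra k V) (hx : ∀ i, SabininTheory.IsPrim (x i))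
    (hy : SabininTheory.IsPrim y) (hz : SabininTheory.IsPrim z) :
    SabininTheory.suBracket F.prod 1 x y z =
      SymmetricAlgebra.ι k V (F.msBracket (fun i => SabininTheory.proj k V (x i))
        (SabininTheory.proj k V y) (SabininTheory.proj k V z)) := by
  open SabininTheory in
  obtain ⟨x, rfl⟩ : ∃ x' : Fin n → V, x = fun i => SymmetricAlgebra.ι k V (x' i) :=
    ⟨_, funext fun i => (hx i).eq_ι_proj⟩
  obtain ⟨y, rfl⟩ : ∃ y', y = SymmetricAlgebra.ι k V y' := ⟨_, hy.eq_ι_proj⟩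
  obtain ⟨z, rfl⟩ : ∃ z', z = SymmetricAlgebra.ι k V z' := ⟨_, hz.eq_ι_proj⟩
  simp only [proj_ι]
  set T := F.connection.torsion (F.connection.adapted y) (F.connection.adapted z) with hT
  set w := (List.ofFn x).foldl (fun a v => F.prod a (SymmetricAlgebra.ι k V v)) 1 with hw
  -- A field and its coordinate agree at `1`, so the bracket is the coordinate of the torsion at
  -- `w`.
  have hms : F.msBracket x y z = convAct F.connection.ldiv T w := by
    rw [FormalLoop.msBracket, ← hT, ← F.connection.convAct_toLin_ldiv T,
      ← F.connection.convAct_toLin_ldiv (List.foldr _ _ _), FlatConnection.convAct_toLin_one,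
      F.nabla_foldr, FlatConnection.convAct_ldiv_toLin, ← hw]
  have hq := LinearMap.congr_fun (F.associatorQuotient_sub y z) w
  rw [← hT] at hq
  simp only [LinearMap.sub_apply, LinearMap.add_apply, LinearMap.comp_apply, ← hms,
    LinearMap.smulRight_apply] at hq
  cases n with
  | zero =>
    have hw1 : w = 1 := by simp [hw]
    -- The associator `(1, b, c)` vanishes; what remains is the counit term, the commutator of `y`
    -- and `z`.
    have h1 : ∀ b c : V, F.associatorQuotient (SymmetricAlgebra.ι k V b)
        (SymmetricAlgebra.ι k V c) 1 = 0 := by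
      intro b c
      have := LinearMap.congr_fun (F.convSMul_associatorQuotient (SymmetricAlgebra.ι k V b)
        (SymmetricAlgebra.ι k V c)) 1
      simpa [convSMul, rightAssociator, Algebra.TensorProduct.one_def, F.one_prod] using this
    rw [hw1, h1, h1, Bialgebra.counit_one, one_smul, sub_zero] at hq
    simp only [suBracket]
    linear_combination (norm := module) hq
  | succ m =>
    -- Split off the last factor: `w` lies in the image of a right multiplication by a vector.
    have hc : counit (R := k) w = 0 := by
      rw [hw, List.ofFn_succ', List.concat_eq_append, List.foldl_append, List.foldl_cons,
        List.foldl_nil, ← LinearMap.flip_apply F.prod, ← F.shift_adapted, counit_shift]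
    rw [hc, zero_smul, add_zero] at hq
    simp only [suBracket, F.primOp_eq, ← hw]
    linear_combination (norm := module) hq
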